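/- For $A\in\mathbb C$ consider the (possibly degenerate) elliptic curve $v^2=\zeta^4+4\zeta^3+4\zeta^2+4A\zeta$. For each $\varphi\in\mathbb R$ let $A_\varphi\in\mathbb C$ be a solution of the Boutroux equations, that is, $$\operatorname{Re}\Bigl(e^{2i\varphi}\oint_{\mathbf c}\frac{v}{\zeta}\,d\zeta\Bigr)=0\quad\text{for every cycle }\mathbf c\text{ on the curve } v^2=\zeta^4+4\zeta^3+4\zeta^2+4A_\varphi\zeta ,$$ where a cycle is a closed path in the set of points $(\zeta,v)\in\mathbb C^2$ of the curve, which may pass through its double points when the curve degenerates. Let $\zeta_1,\zeta_3,\zeta_5$ (depending on $\varphi$) be the zeros, with multiplicity, of $\zeta^3+4\zeta^2+4\zeta+4A_\varphi$, numbered so that $\operatorname{Re}\zeta_5\le\operatorname{Re}\zeta_3\le\operatorname{Re}\zeta_1$, and write $A_\varphi=\tfrac{8}{27}+\varepsilon_\varphi$. Then, as $\varphi\to0$, $\varphi\neq0$ (from either side), $$\varepsilon_\varphi=\frac{8i}{3}\,\frac{\varphi}{\ln|\varphi|}\Bigl(1+O\Bigl(\frac{\ln|\ln|\varphi||}{\ln|\varphi|}\Bigr)\Bigr).$$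 Moreover, with $\sqrt{\cdot}$ the principal square root, as $\varphi\to0-$, $$\zeta_p=-\tfrac23-i^{p}\sqrt{2\varepsilon_\varphi}+O(\varepsilon_\varphi)\quad(p=1,3),\qquad \zeta_5=-\tfrac83-\varepsilon_\varphi+O(\varepsilon_\varphi^2),$$ and, as $\varphi\to0+$, $$\zeta_p=-\tfrac23+i^{p}\sqrt{2\varepsilon_\varphi}+O(\varepsilon_\varphi)\quad(p=1,3),\qquad \zeta_5=-\tfrac83-\varepsilon_\varphi+O(\varepsilon_\varphi^2).$$ -/

import Mathlib

open Filter Topology Asymptotics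

/-- The polynomial `v(A, ζ)² = ζ⁴ + 4ζ³ + 4ζ² + 4Aζ`. -/
noncomputable def boutrouxQuartic (A ζ : ℂ) : ℂ :=
  ζ ^ 4 + 4 * ζ ^ 3 + 4 * ζ ^ 2 + 4 * A * ζ

/-- A cycle on the (possibly degenerate) algebraic curve `v² = ζ⁴ + 4ζ³ + 4ζ² + 4Aζ`:
a closed path `t ↦ (γ t, v t)`, `0 ≤ t ≤ 1`, in the set of points `(ζ, v) ∈ ℂ²` of the curve,
continuous, with continuously differentiable projection `γ` to the `ζ`-plane, and such that
the line integral `∫ (v / ζ) dζ` along it converges absolutely. The last clause only matters when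
the path runs through the branch point `ζ = 0`, where `v / ζ` is unbounded.
Paths may run through branch points, and through the double points when the curve degenerates. -/
structure IsBoutrouxCycle (A : ℂ) (γ v : ℝ → ℂ) : Prop where
  contDiff : ContDiff ℝ 1 γ
  continuous : Continuous v
  closed_base : γ 0 = γ 1
  closed_fibre : v 0 = v 1
  on_curve : ∀ t ∈ Set.Icc (0 : ℝ) 1, v t ^ 2 = boutrouxQuartic A (γ t)
  integrable : IntervalIntegrable (fun t => v t / γ t * deriv γ t) MeasureTheory.volume 0 1

/-- The Boutroux equations for the angle `φ`: `Re (e^{2iφ} ∮ (v(A, ζ) / ζ) dζ) = 0` for every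
cycle on the curve `v² = ζ⁴ + 4ζ³ + 4ζ² + 4Aζ`. -/
def SolvesBoutroux (φ : ℝ) (A : ℂ) : Prop :=
  ∀ γ v : ℝ → ℂ, IsBoutrouxCycle A γ v →
    (Complex.exp (2 * Complex.I * φ) * ∫ t in (0 : ℝ)..1, v t / γ t * deriv γ t).re = 0

/-- `ζ₁, ζ₃, ζ₅` are the zeros, with multiplicity, of `ζ³ + 4ζ² + 4ζ + 4A`, numbered so that
`Re ζ₅ ≤ Re ζ₃ ≤ Re ζ₁`. -/
structure AreBranchPoints (A ζ₁ ζ₃ ζ₅ : ℂ) : Prop where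
  factor : ∀ z : ℂ, z ^ 3 + 4 * z ^ 2 + 4 * z + 4 * A = (z - ζ₁) * (z - ζ₃) * (z - ζ₅)
  re_le_53 : ζ₅.re ≤ ζ₃.re
  re_le_31 : ζ₃.re ≤ ζ₁.re

/-! The differential `(v/ζ) dζ` has two kinds of periods that matter: from `0` to a zero `r` and
back on the other sheet, and around two zeros `m ± d`. Both become trigonometric integrals with a
continuous integrand (`im_period_zero_root`, `re_period_root_root`). The proof uses no other cycles.

Global part: `tendsto_roots` shows that the zeros tend to `-2/3, -2/3, -8/3`. By
`IsRootTriple.cofactor` the period from `0` to `r` depends on `r` alone, and continuously so on a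
closed half plane. After rescaling, every ultrafilter converging to `0` gives limiting zeros whose
periods satisfy the equations for `φ = 0`. Escape to infinity would put three limits with zero sum
and zero sum of squares on the coordinate axes, so all would vanish. For finite limits the leftmost
zero lies in an explicit region; its period, that of another zero, or the cycle around a conjugate
pair violates the equations unless the curve is the degenerate one.

Local part: write the zeros as `-2/3 + μ ± d` and `-8/3 - 2μ`, so `d² ≈ -4μ` and `ε ≈ 2μ ≈ -d²/2`.
Put `w = e^{2iφ} d²`. The cycle around the colliding pair gives `Re w = O(|d|³)` (`abs_re_le`). The
period from `0` to `ζ₁` is, up to sign, `1/√3 + (√3/4) d² log|d| + O(|d|²)` (`norm_period_sub_le`),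
hence `sin 2φ/√3 + (√3/4) log|d| · Im w = O(|d|²)` (`abs_sin_add_le`). With `a = -log|d|` this reads
`a · Im w ≈ 8φ/3`; since `log|φ| = -2a + O(log a)` and `ε ≈ -i Im w/2`, the formula for `ε` follows,
the `log a` being the source of the iterated logarithm in the error.

For the branch points, `d² + 2ε = O(|d|⁴)`, so `d` is close to one of `±i√(2ε)`. The sign is decided
by `Re d ≥ 0`, which is the numbering of the zeros, and by the sign of `Im ε`, which is opposite to
that of `φ`. -/

section
open Complex MeasureTheory

/-! ### Explicit cycles and their periods. -/

theorem ae_cos_pi_mul_ne_zero :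
    ∀ᵐ t : ℝ, t ∈ Set.uIoc (0 : ℝ) 1 → Real.cos (Real.pi * t) ≠ 0 := by
  have h : ∀ᵐ t : ℝ, t ≠ 1 / 2 := by simp [ae_iff]
  filter_upwards [h] with t ht hmem hcos
  rw [Set.uIoc_of_le zero_le_one] at hmem
  apply ht
  have hpi := Real.pi_pos
  have := Real.injOn_cos (x₁ := Real.pi * t) (x₂ := Real.pi / 2)
    ⟨by nlinarith [hmem.1], by nlinarith [hmem.2]⟩ ⟨by linarith, by linarith⟩
    (by rw [hcos, Real.cos_pi_div_two])
  field_simp at this ⊢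
  linarith

/-- The period over the segment from `0` to a root `r`. -/
theorem SolvesBoutroux.im_period_zero_root {φ : ℝ} {A r r' r'' : ℂ} (hS : SolvesBoutroux φ A)
    (hf : ∀ z, boutrouxQuartic A z = z * (z - r) * (z - r') * (z - r''))
    (h : ℝ → ℂ) (hc : ContinuousOn h (Set.Icc 0 1))
    (hsq : ∀ s ∈ Set.Icc (0 : ℝ) 1, h s ^ 2 = (r * s - r') * (r * s - r'')) :
    (exp (2 * I * φ) * (r * ∫ θ in (0 : ℝ)..(Real.pi / 2),
      (Real.sin θ : ℂ) ^ 2 * h (Real.cos θ ^ 2))).im = 0 := by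
  rcases eq_or_ne r 0 with rfl | hr
  · simp
  have hcont : Continuous fun t : ℝ => h (Real.cos t ^ 2) :=
    hc.comp_continuous (by fun_prop) fun t => ⟨by positivity, Real.cos_sq_le_one t⟩
  have hcont' : Continuous fun t : ℝ => h (Real.cos (Real.pi * t) ^ 2) :=
    hcont.comp (continuous_const.mul continuous_id)
  -- The path runs from `r` to `0` and back; `sin · cos` changes sign at `t = 1/2`, so the return is
  -- on the other sheet. The factor `cos` in both `v` and `γ'` cancels the `cos²` in `γ`.
  set γ : ℝ → ℂ := fun t => r * ((Real.cos (Real.pi * t) ^ 2 : ℝ) : ℂ) with hγ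
  set v : ℝ → ℂ := fun t => I * r * ((Real.sin (Real.pi * t) * Real.cos (Real.pi * t) : ℝ) : ℂ) *
    h (Real.cos (Real.pi * t) ^ 2) with hv
  set G : ℝ → ℂ := fun θ => (Real.sin θ : ℂ) ^ 2 * h (Real.cos θ ^ 2) with hG
  have hGc : Continuous G :=
    ((continuous_ofReal.comp Real.continuous_sin).pow 2).mul hcont
  have hder : ∀ t, deriv γ t = r * ((-(2 * Real.pi) * (Real.sin (Real.pi * t) *
      Real.cos (Real.pi * t)) : ℝ) : ℂ) := by
    intro t
    have h1 : HasDerivAt (fun t : ℝ => Real.cos (Real.pi * t) ^ 2)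
        (-(2 * Real.pi) * (Real.sin (Real.pi * t) * Real.cos (Real.pi * t))) t := by
      have := (((hasDerivAt_id t).const_mul Real.pi).cos).pow 2
      convert! this using 1
      simp; ring
    exact (h1.ofReal_comp.const_mul r).deriv
  -- Only almost everywhere: at `t = 1/2` the path is at the branch point `0` and `v / γ` is a
  -- division by zero.
  have hae : ∀ᵐ t : ℝ, t ∈ Set.uIoc (0 : ℝ) 1 →
      -(2 * Real.pi) * I * r * G (Real.pi * t) = v t / γ t * deriv γ t := by
    filter_upwards [ae_cos_pi_mul_ne_zero] with t ht hmem
    have hc0 : (Real.cos (Real.pi * t) : ℂ) ≠ 0 := by exact_mod_cast ht hmem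
    rw [hder]
    simp only [hv, hγ, hG]
    push_cast at hc0 ⊢
    field_simp
  have hcyc : IsBoutrouxCycle A γ v := by
    refine ⟨?_, Continuous.mul (by fun_prop) hcont', by simp [hγ], by simp [hv], ?_, ?_⟩
    · have : ContDiff ℝ 1 fun t : ℝ => Real.cos (Real.pi * t) ^ 2 := by fun_prop
      exact contDiff_const.mul (Complex.ofRealCLM.contDiff.comp this)
    · intro t _
      have hs := hsq (Real.cos (Real.pi * t) ^ 2) ⟨by positivity, Real.cos_sq_le_one _⟩
      have hsc : (Real.sin (Real.pi * t) : ℂ) ^ 2 = 1 - (Real.cos (Real.pi * t) : ℂ) ^ 2 := by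
        rw [← ofReal_pow, Real.sin_sq]; push_cast; ring
      simp only [hv, hγ, hf]
      rw [mul_pow, hs]
      push_cast at hsc ⊢
      simp only [mul_pow, hsc, I_sq]
      ring
    · refine IntervalIntegrable.congr_ae (f := fun t => -(2 * Real.pi) * I * r * G (Real.pi * t))
        (Continuous.intervalIntegrable (by fun_prop) _ _) ?_
      rw [Filter.EventuallyEq, ae_restrict_iff' measurableSet_uIoc]
      exact hae
  have hint : ∫ t in (0 : ℝ)..1, v t / γ t * deriv γ t
      = -4 * I * (r * ∫ θ in (0 : ℝ)..(Real.pi / 2), G θ) := by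
    rw [← intervalIntegral.integral_congr_ae hae, intervalIntegral.integral_const_mul,
      intervalIntegral.integral_comp_mul_left G Real.pi_ne_zero]
    have hsplit : ∫ θ in (Real.pi * 0)..(Real.pi * 1), G θ
        = 2 * ∫ θ in (0 : ℝ)..(Real.pi / 2), G θ := by
      have h2 : ∫ θ in (Real.pi / 2)..Real.pi, G θ = ∫ θ in (0 : ℝ)..(Real.pi / 2), G θ := by
        have := intervalIntegral.integral_comp_sub_left (a := 0) (b := Real.pi / 2) G Real.pi
        rw [sub_zero, show Real.pi - Real.pi / 2 = Real.pi / 2 by ring] at this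
        rw [← this]
        refine intervalIntegral.integral_congr fun θ _ => ?_
        simp only [hG, Real.sin_pi_sub, Real.cos_pi_sub, neg_sq]
      rw [mul_zero, mul_one, ← intervalIntegral.integral_add_adjacent_intervals
        (hGc.intervalIntegrable 0 (Real.pi / 2)) (hGc.intervalIntegrable _ _), h2, two_mul]
    rw [hsplit, real_smul]
    have hpi : (Real.pi : ℂ) ≠ 0 := by exact_mod_cast Real.pi_ne_zero
    push_cast
    field_simp
    ring
  have key := hS γ v hcyc
  rw [hint] at key
  set W := exp (2 * I * φ) * (r * ∫ θ in (0 : ℝ)..(Real.pi / 2), G θ) with hW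
  rw [show exp (2 * I * φ) * (-4 * I * (r * ∫ θ in (0 : ℝ)..(Real.pi / 2), G θ)) = -4 * I * W by
    rw [hW]; ring] at key
  simpa using key

/-- The period over the segment between two roots `m ± d`, expressed through the third root. -/
theorem SolvesBoutroux.re_period_root_root {φ : ℝ} {A m d r : ℂ} (hS : SolvesBoutroux φ A)
    (hf : ∀ z, boutrouxQuartic A z = z * (z - (m + d)) * (z - (m - d)) * (z - r))
    (h0 : ∀ x ∈ Set.Icc (-1 : ℝ) 1, m + d * x ≠ 0)
    (hs : ∀ x ∈ Set.Icc (-1 : ℝ) 1, r / (m + d * x) - 1 ∈ slitPlane) :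
    (exp (2 * I * φ) * (d ^ 2 * ∫ t in (0 : ℝ)..1, (Real.sin (2 * Real.pi * t) : ℂ) ^ 2 *
      Complex.sqrt (r / (m + d * Real.cos (2 * Real.pi * t)) - 1))).re = 0 := by
  set γ : ℝ → ℂ := fun t => m + d * (Real.cos (2 * Real.pi * t) : ℂ) with hγ
  have hmem : ∀ t : ℝ, Real.cos (2 * Real.pi * t) ∈ Set.Icc (-1 : ℝ) 1 := fun t =>
    ⟨Real.neg_one_le_cos _, Real.cos_le_one _⟩
  have hγ0 : ∀ t, γ t ≠ 0 := fun t => h0 _ (hmem t)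
  have hγs : ∀ t, r / γ t - 1 ∈ slitPlane := fun t => hs _ (hmem t)
  have hγc : Continuous γ := by simp only [hγ]; fun_prop
  set k : ℝ → ℂ := fun t => Complex.sqrt (r / γ t - 1) with hk
  have hkc : Continuous k := by
    refine Continuous.cpow ?_ continuous_const hγs
    exact (continuous_const.div hγc hγ0).sub continuous_const
  have hk2 : ∀ t, k t ^ 2 = r / γ t - 1 := fun t => by
    simp [hk, Complex.sqrt]
  -- The root of `ζ(r - ζ)` is taken as `ζ √(r/ζ - 1)`: at the double point `r/ζ - 1 = 3`, far from
  -- the cut of the principal branch.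
  set v : ℝ → ℂ := fun t => -(d * (Real.sin (2 * Real.pi * t) : ℂ) * (γ t * k t)) with hv
  have hder : ∀ t, deriv γ t = d * ((-(2 * Real.pi) * Real.sin (2 * Real.pi * t) : ℝ) : ℂ) := by
    intro t
    have h1 : HasDerivAt (fun t : ℝ => Real.cos (2 * Real.pi * t))
        (-(2 * Real.pi) * Real.sin (2 * Real.pi * t)) t := by
      have := ((hasDerivAt_id t).const_mul (2 * Real.pi)).cos
      convert! this using 1
      simp; ring
    exact ((h1.ofReal_comp.const_mul d).const_add m).deriv
  have heq : ∀ t, v t / γ t * deriv γ t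
      = 2 * Real.pi * (d ^ 2 * ((Real.sin (2 * Real.pi * t) : ℂ) ^ 2 * k t)) := by
    intro t
    rw [hder]
    have := hγ0 t
    simp only [hv]
    push_cast
    field_simp
  have hcyc : IsBoutrouxCycle A γ v := by
    refine ⟨?_, by simp only [hv]; fun_prop, by simp [hγ], by simp [hv], ?_, ?_⟩
    · have : ContDiff ℝ 1 fun t : ℝ => Real.cos (2 * Real.pi * t) := by fun_prop
      exact contDiff_const.add (contDiff_const.mul (Complex.ofRealCLM.contDiff.comp this))
    · intro t _
      have hsc : (Real.sin (2 * Real.pi * t) : ℂ) ^ 2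
          = 1 - (Real.cos (2 * Real.pi * t) : ℂ) ^ 2 := by
        rw [← ofReal_pow, Real.sin_sq]; push_cast; ring
      have hg : γ t - m = d * (Real.cos (2 * Real.pi * t) : ℂ) := by simp [hγ]
      have h2 : γ t * k t ^ 2 = r - γ t := by rw [hk2]; have := hγ0 t; field_simp
      rw [hf]
      calc v t ^ 2 = d ^ 2 * (Real.sin (2 * Real.pi * t) : ℂ) ^ 2 * γ t * (γ t * k t ^ 2) := by
            simp only [hv]; ring
        _ = γ t * (d ^ 2 - (d * (Real.cos (2 * Real.pi * t) : ℂ)) ^ 2) * (r - γ t) := by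
            rw [hsc, h2]; ring
        _ = _ := by rw [← hg]; ring
    · simp_rw [heq]
      exact Continuous.intervalIntegrable (by fun_prop) _ _
  have key := hS γ v hcyc
  simp_rw [heq] at key
  rw [intervalIntegral.integral_const_mul, intervalIntegral.integral_const_mul] at key
  set W := exp (2 * I * φ) * (d ^ 2 * ∫ t in (0 : ℝ)..1, (Real.sin (2 * Real.pi * t) : ℂ) ^ 2 *
      k t) with hW
  rw [show exp (2 * I * φ) * (2 * Real.pi * (d ^ 2 *
    ∫ t in (0 : ℝ)..1, (Real.sin (2 * Real.pi * t) : ℂ) ^ 2 * k t)) = ((2 * Real.pi : ℝ) : ℂ) * W by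
    rw [hW]; push_cast; ring, re_ofReal_mul] at key
  exact (mul_eq_zero.mp key).resolve_left (by positivity)

/-! ### A square root continuous up to the real axis. -/

/-- The continuous function on `ℂ` which is the square root with values in the first quadrant on
the closed upper half plane, and is invariant under conjugation. -/
noncomputable def usqrt (z : ℂ) : ℂ :=
  ⟨√((‖z‖ + z.re) / 2), √((‖z‖ - z.re) / 2)⟩

lemma continuous_usqrt : Continuous usqrt := by
  have : usqrt = fun z => ((√((‖z‖ + z.re) / 2) : ℝ) : ℂ) + (√((‖z‖ - z.re) / 2) : ℝ) * I := by
    ext z; apply Complex.ext <;> simp [usqrt]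
  rw [this]
  fun_prop

lemma usqrt_re_nonneg (z : ℂ) : 0 ≤ (usqrt z).re := Real.sqrt_nonneg _

lemma usqrt_im_nonneg (z : ℂ) : 0 ≤ (usqrt z).im := Real.sqrt_nonneg _

lemma usqrt_re_sq_sub (z : ℂ) : (usqrt z).re ^ 2 - (usqrt z).im ^ 2 = z.re := by
  have h1 := abs_le.mp (abs_re_le_norm z)
  simp only [usqrt]
  rw [Real.sq_sqrt (by linarith), Real.sq_sqrt (by linarith)]
  ring

lemma usqrt_re_mul_im (z : ℂ) : 2 * ((usqrt z).re * (usqrt z).im) = |z.im| := by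
  have h1 := abs_le.mp (abs_re_le_norm z)
  simp only [usqrt]
  have h0 : 0 ≤ (‖z‖ + z.re) / 2 := by linarith
  rw [← Real.sqrt_mul h0, ← Real.sqrt_sq_eq_abs]
  have : z.im ^ 2 = 2 ^ 2 * ((‖z‖ + z.re) / 2 * ((‖z‖ - z.re) / 2)) := by
    have := Complex.sq_norm z
    rw [normSq_apply] at this
    nlinarith
  rw [this, Real.sqrt_mul (x := 2 ^ 2) (by norm_num), Real.sqrt_sq (by norm_num)]

lemma usqrt_sq {z : ℂ} (hz : 0 ≤ z.im) : usqrt z ^ 2 = z := by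
  have h1 := usqrt_re_sq_sub z
  have h2 := usqrt_re_mul_im z
  rw [abs_of_nonneg hz] at h2
  apply Complex.ext <;> simp [pow_two] <;> nlinarith

lemma usqrt_ofReal_mul {c : ℝ} (hc : 0 ≤ c) (z : ℂ) : usqrt (c * z) = (√c : ℝ) * usqrt z := by
  apply Complex.ext
  · simp only [usqrt, norm_mul, norm_real, Real.norm_eq_abs, abs_of_nonneg hc, re_ofReal_mul]
    rw [← Real.sqrt_mul hc]; congr 1; ring
  · simp only [usqrt, norm_mul, norm_real, Real.norm_eq_abs, abs_of_nonneg hc, re_ofReal_mul,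
      im_ofReal_mul]
    rw [← Real.sqrt_mul hc]; congr 1; ring

/-- Reflection into the closed upper half plane. -/
def reflectUp (z : ℂ) : ℂ := ⟨z.re, |z.im|⟩

lemma continuous_reflectUp : Continuous reflectUp := by
  have : reflectUp = fun z => (z.re : ℂ) + (|z.im| : ℝ) * I := by
    ext z; apply Complex.ext <;> simp [reflectUp]
  rw [this]
  fun_prop

/-! ### The period from `0` to a zero as a function of that zero alone. -/

/-- The elementary symmetric functions of the zeros of `ζ³ + 4ζ² + 4ζ + 4A`. -/
structure IsRootTriple (A r r' r'' : ℂ) : Prop where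
  sum : r + r' + r'' = -4
  sum_mul : r * r' + r * r'' + r' * r'' = 4
  prod : r * r' * r'' = -4 * A

lemma AreBranchPoints.isRootTriple {A r r' r'' : ℂ} (h : AreBranchPoints A r r' r'') :
    IsRootTriple A r r' r'' := by
  have h0 := h.factor 0
  have h1 := h.factor 1
  have h2 := h.factor (-1)
  constructor
  · linear_combination (h1 + h2) / 2 - h0
  · linear_combination (h2 - h1) / 2
  · linear_combination h0

namespace IsRootTriple

variable {A r r' r'' : ℂ}

lemma swap (h : IsRootTriple A r r' r'') : IsRootTriple A r' r r'' :=
  ⟨by linear_combination h.sum, by linear_combination h.sum_mul, by linear_combination h.prod⟩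

lemma rotate (h : IsRootTriple A r r' r'') : IsRootTriple A r'' r r' :=
  ⟨by linear_combination h.sum, by linear_combination h.sum_mul, by linear_combination h.prod⟩

lemma quartic (h : IsRootTriple A r r' r'') (z : ℂ) :
    boutrouxQuartic A z = z * (z - r) * (z - r') * (z - r'') := by
  unfold boutrouxQuartic
  linear_combination z ^ 3 * h.sum - z ^ 2 * h.sum_mul + z * h.prod

/-- The sum and product of the other two zeros are polynomials in `r`, which eliminates them. For
real `w` both factors on the right have the form `c r + 2` with `c > 0`, so they stay in the closed
upper half plane with `r` and `usqrt` gives a continuous branch of the root. -/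
lemma cofactor (h : IsRootTriple A r r' r'') (w : ℂ) :
    (r * w ^ 2 - r') * (r * w ^ 2 - r'')
      = ((1 + w + w ^ 2) * r + 2) * ((1 - w + w ^ 2) * r + 2) := by
  have h1 : r' + r'' = -4 - r := by linear_combination h.sum
  have h2 : r' * r'' = 4 + 4 * r + r ^ 2 := by linear_combination h.sum_mul - r * h1
  linear_combination (-(r * w ^ 2)) * h1 + h2

end IsRootTriple

/-- The integrand of the period over the segment from `0` to the root `z` of the curve rescaled
by the factor `κ`, for `z` in the closed upper half plane. -/
noncomputable def segmentIntegrand (z : ℂ) (κ θ : ℝ) : ℂ :=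
  (Real.sin θ : ℂ) ^ 2 *
    (usqrt (((1 + Real.cos θ + Real.cos θ ^ 2 : ℝ) : ℂ) * z + 2 * κ) *
      usqrt (((1 - Real.cos θ + Real.cos θ ^ 2 : ℝ) : ℂ) * z + 2 * κ))

/-- The part of that period which the Boutroux equation for the angle `φ` annihilates. -/
noncomputable def segmentPeriod (φ : ℝ) (z : ℂ) (κ : ℝ) : ℝ :=
  (exp (2 * I * φ) * (z * ∫ θ in (0 : ℝ)..(Real.pi / 2), segmentIntegrand z κ θ)).im

lemma continuous_segmentIntegrand :
    Continuous fun p : (ℂ × ℝ) × ℝ => segmentIntegrand p.1.1 p.1.2 p.2 := by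
  unfold segmentIntegrand
  have := continuous_usqrt
  fun_prop

lemma continuous_segmentIntegrand_right (z : ℂ) (κ : ℝ) : Continuous (segmentIntegrand z κ) := by
  unfold segmentIntegrand
  have := continuous_usqrt
  fun_prop

lemma continuous_segmentPeriod :
    Continuous fun p : ℝ × ℂ × ℝ => segmentPeriod p.1 p.2.1 p.2.2 := by
  have h : Continuous fun q : ℂ × ℝ =>
      ∫ θ in (0 : ℝ)..(Real.pi / 2), segmentIntegrand q.1 q.2 θ :=
    intervalIntegral.continuous_parametric_intervalIntegral_of_continuous'
      continuous_segmentIntegrand _ _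
  have h2 := h.comp (continuous_snd (X := ℝ) (Y := ℂ × ℝ))
  unfold segmentPeriod
  refine Complex.continuous_im.comp ?_
  refine Continuous.mul (by fun_prop) (Continuous.mul (by fun_prop) h2)

/-- Homogeneity, which allows the zeros to be normalised by their size; `κ → 0` then describes zeros
escaping to infinity. -/
lemma segmentPeriod_div (φ : ℝ) (z : ℂ) {R : ℝ} (hR : 0 < R) :
    segmentPeriod φ (z / R) (1 / R) = segmentPeriod φ z 1 / R ^ 2 := by
  have key : ∀ θ, segmentIntegrand (z / R) (1 / R) θ = (R : ℂ)⁻¹ * segmentIntegrand z 1 θ := by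
    intro θ
    have h : ∀ c : ℝ, usqrt ((c : ℂ) * (z / R) + 2 * ((1 / R : ℝ) : ℂ))
        = (√(R⁻¹) : ℝ) * usqrt ((c : ℂ) * z + 2 * ((1 : ℝ) : ℂ)) := by
      intro c
      rw [← usqrt_ofReal_mul (by positivity)]
      congr 1; push_cast; ring
    have h2 : ((√(R⁻¹) : ℝ) : ℂ) * ((√(R⁻¹) : ℝ) : ℂ) = (R : ℂ)⁻¹ := by
      rw [← ofReal_mul, Real.mul_self_sqrt (by positivity), ofReal_inv]
    unfold segmentIntegrand
    rw [h, h, ← h2]; ring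
  unfold segmentPeriod
  simp_rw [key]
  rw [intervalIntegral.integral_const_mul]
  set J := ∫ θ in (0 : ℝ)..(Real.pi / 2), segmentIntegrand z 1 θ
  rw [show exp (2 * I * φ) * (z / R * ((R : ℂ)⁻¹ * J))
    = (((R ^ 2)⁻¹ : ℝ) : ℂ) * (exp (2 * I * φ) * (z * J)) by push_cast; field_simp, im_ofReal_mul]
  ring

lemma segmentPeriod_zero_eq (z : ℂ) (κ : ℝ) :
    segmentPeriod 0 z κ = ∫ θ in (0 : ℝ)..(Real.pi / 2), (z * segmentIntegrand z κ θ).im := by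
  have hc : Continuous fun θ => z * segmentIntegrand z κ θ :=
    continuous_const.mul (continuous_segmentIntegrand_right z κ)
  have := Complex.imCLM.intervalIntegral_comp_comm (hc.intervalIntegrable (μ := volume) 0 (Real.pi / 2))
  simp only [imCLM_apply] at this
  rw [this, intervalIntegral.integral_const_mul]
  simp [segmentPeriod]

lemma SolvesBoutroux.segmentPeriod_eq_zero {φ : ℝ} {A r r' r'' : ℂ} (hS : SolvesBoutroux φ A)
    (h : IsRootTriple A r r' r'') (hr : 0 ≤ r.im) : segmentPeriod φ r 1 = 0 := by
  have key := hS.im_period_zero_root h.quartic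
    (fun s => usqrt (((1 + √s + √s ^ 2 : ℝ) : ℂ) * r + 2 * (1 : ℝ)) *
      usqrt (((1 - √s + √s ^ 2 : ℝ) : ℂ) * r + 2 * (1 : ℝ)))
    (by have := continuous_usqrt; fun_prop) ?_
  · rw [← key]
    unfold segmentPeriod
    congr 3
    refine intervalIntegral.integral_congr fun θ hθ => ?_
    rw [Set.uIcc_of_le (by positivity)] at hθ
    have hcos : 0 ≤ Real.cos θ :=
      Real.cos_nonneg_of_mem_Icc ⟨by linarith [hθ.1, Real.pi_pos], hθ.2⟩
    simp only [segmentIntegrand, Real.sqrt_sq hcos]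
  · intro s hs
    have h1 : 0 ≤ √s := Real.sqrt_nonneg s
    have h2 : √s ^ 2 = s := Real.sq_sqrt hs.1
    have him : ∀ c : ℝ, 0 ≤ c → 0 ≤ ((c : ℂ) * r + 2 * (1 : ℝ)).im := by
      intro c hc; simp; positivity
    simp only [mul_pow]
    rw [usqrt_sq (him _ (by positivity)),
      usqrt_sq (him _ (by nlinarith [sq_nonneg (√s - 1 / 2)]))]
    have := h.cofactor (√s : ℝ)
    rw [← ofReal_pow, h2] at this
    rw [this, h2]
    push_cast; ring

/-- Conjugating the period reverses the angle and moves `r` to the upper half plane. -/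
lemma SolvesBoutroux.segmentPeriod_conj_eq_zero {φ : ℝ} {A r r' r'' : ℂ}
    (hS : SolvesBoutroux φ A) (h : IsRootTriple A r r' r'') (hr : r.im ≤ 0) :
    segmentPeriod (-φ) ((starRingEnd ℂ) r) 1 = 0 := by
  set rc := (starRingEnd ℂ) r with hrc
  have key := hS.im_period_zero_root h.quartic
    (fun s => (starRingEnd ℂ) (usqrt (((1 + √s + √s ^ 2 : ℝ) : ℂ) * rc + 2 * (1 : ℝ)) *
      usqrt (((1 - √s + √s ^ 2 : ℝ) : ℂ) * rc + 2 * (1 : ℝ))))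
    (by
      have := continuous_usqrt
      exact (Complex.continuous_conj.comp (by fun_prop)).continuousOn) ?_
  · have hint : ∫ θ in (0 : ℝ)..(Real.pi / 2), (Real.sin θ : ℂ) ^ 2 *
        (starRingEnd ℂ) (usqrt (((1 + √(Real.cos θ ^ 2) + √(Real.cos θ ^ 2) ^ 2 : ℝ) : ℂ) * rc
          + 2 * (1 : ℝ)) * usqrt (((1 - √(Real.cos θ ^ 2) + √(Real.cos θ ^ 2) ^ 2 : ℝ) : ℂ) * rc
          + 2 * (1 : ℝ)))
        = (starRingEnd ℂ) (∫ θ in (0 : ℝ)..(Real.pi / 2), segmentIntegrand rc 1 θ) := by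
      have hc := continuous_segmentIntegrand_right rc 1
      have := Complex.conjCLE.toContinuousLinearMap.intervalIntegral_comp_comm
        (hc.intervalIntegrable (μ := volume) 0 (Real.pi / 2))
      simp only [ContinuousLinearEquiv.coe_coe, conjCLE_apply] at this
      rw [← this]
      refine intervalIntegral.integral_congr fun θ hθ => ?_
      rw [Set.uIcc_of_le (by positivity)] at hθ
      have hcos : 0 ≤ Real.cos θ :=
        Real.cos_nonneg_of_mem_Icc ⟨by linarith [hθ.1, Real.pi_pos], hθ.2⟩
      simp only [segmentIntegrand, Real.sqrt_sq hcos, map_mul, map_pow, conj_ofReal]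
    rw [hint] at key
    unfold segmentPeriod
    rw [← neg_eq_zero, ← conj_im]
    refine Eq.trans ?_ key
    congr 1
    simp only [map_mul, ← exp_conj, conj_ofReal, conj_I, hrc, conj_conj, map_ofNat]
    push_cast
    ring_nf
  · intro s hs
    have h1 : 0 ≤ √s := Real.sqrt_nonneg s
    have h2 : √s ^ 2 = s := Real.sq_sqrt hs.1
    have hrc0 : 0 ≤ rc.im := by simp [hrc, hr]
    have him : ∀ c : ℝ, 0 ≤ c → 0 ≤ ((c : ℂ) * rc + 2 * (1 : ℝ)).im := by
      intro c hc; simp; positivity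
    simp only [← map_pow, mul_pow]
    rw [usqrt_sq (him _ (by positivity)),
      usqrt_sq (him _ (by nlinarith [sq_nonneg (√s - 1 / 2)]))]
    have := h.cofactor (√s : ℝ)
    rw [← ofReal_pow, h2] at this
    rw [this, h2]
    simp only [map_mul, map_add, hrc, conj_conj, conj_ofReal, map_ofNat]
    push_cast; ring

/-- The product form is independent of the half plane containing `r`, so limits can be taken even if
`r` changes sides. As `φ → 0` both factors have the same limit. -/
lemma SolvesBoutroux.segmentPeriod_reflectUp {φ : ℝ} {A r r' r'' : ℂ}
    (hS : SolvesBoutroux φ A) (h : IsRootTriple A r r' r'') :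
    segmentPeriod φ (reflectUp r) 1 * segmentPeriod (-φ) (reflectUp r) 1 = 0 := by
  rcases le_total 0 r.im with hr | hr
  · have : reflectUp r = r := Complex.ext rfl (abs_of_nonneg hr)
    rw [this, hS.segmentPeriod_eq_zero h hr, zero_mul]
  · have : reflectUp r = (starRingEnd ℂ) r := Complex.ext rfl (abs_of_nonpos hr)
    rw [this, hS.segmentPeriod_conj_eq_zero h hr, mul_zero]

lemma segmentPeriod_limit {U : Filter ℝ} [NeBot U] (hU : U ≤ 𝓝 0) {A r r' r'' : ℝ → ℂ}
    (hS : ∀ φ, SolvesBoutroux φ (A φ)) (h : ∀ φ, IsRootTriple (A φ) (r φ) (r' φ) (r'' φ))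
    {R : ℝ → ℝ} (hR : ∀ φ, 0 < R φ) {z : ℂ} {κ : ℝ}
    (hz : Tendsto (fun φ => r φ / R φ) U (𝓝 z)) (hκ : Tendsto (fun φ => 1 / R φ) U (𝓝 κ)) :
    segmentPeriod 0 (reflectUp z) κ = 0 := by
  have hzero : ∀ φ, segmentPeriod φ (reflectUp (r φ / R φ)) (1 / R φ) *
      segmentPeriod (-φ) (reflectUp (r φ / R φ)) (1 / R φ) = 0 := by
    intro φ
    have : reflectUp (r φ / R φ) = reflectUp (r φ) / R φ := by
      apply Complex.ext
      · simp [reflectUp]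
      · simp [reflectUp, abs_div, abs_of_pos (hR φ)]
    rw [this, segmentPeriod_div _ _ (hR φ), segmentPeriod_div _ _ (hR φ), div_mul_div_comm,
      (hS φ).segmentPeriod_reflectUp (h φ), zero_div]
  have hid : Tendsto (fun φ : ℝ => φ) U (𝓝 0) := hU
  have hneg : Tendsto (fun φ : ℝ => -φ) U (𝓝 0) := by simpa using hid.neg
  have hup := (continuous_reflectUp.tendsto z).comp hz
  have l1 := (continuous_segmentPeriod.tendsto (0, reflectUp z, κ)).comp
    (hid.prodMk_nhds (hup.prodMk_nhds hκ))
  have l2 := (continuous_segmentPeriod.tendsto (0, reflectUp z, κ)).comp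
    (hneg.prodMk_nhds (hup.prodMk_nhds hκ))
  have l3 := (l1.mul l2).congr (f₂ := fun _ => (0 : ℝ)) hzero
  have := tendsto_nhds_unique l3 tendsto_const_nhds
  simpa using this

/-! ### Signs of the period at angle zero. -/

lemma segmentIntegrand_im (z : ℂ) (κ θ : ℝ) :
    (z * segmentIntegrand z κ θ).im = Real.sin θ ^ 2 *
      (z * (usqrt (((1 + Real.cos θ + Real.cos θ ^ 2 : ℝ) : ℂ) * z + 2 * κ) *
      usqrt (((1 - Real.cos θ + Real.cos θ ^ 2 : ℝ) : ℂ) * z + 2 * κ))).im := by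
  unfold segmentIntegrand
  rw [mul_left_comm, ← ofReal_pow, im_ofReal_mul]

lemma im_mul_usqrt_mul_usqrt (z : ℂ) (k l : ℝ) (hk : 0 < k) (hl : 0 < l) (hz : 0 ≤ z.im) :
    ∃ a a' b b' : ℝ, 0 ≤ a ∧ 0 ≤ a' ∧ 0 ≤ b ∧ 0 ≤ b' ∧ a ^ 2 - a' ^ 2 = k * z.re + 2 ∧
      2 * (a * a') = k * z.im ∧ b ^ 2 - b' ^ 2 = l * z.re + 2 ∧ 2 * (b * b') = l * z.im ∧
      (z * (usqrt ((k : ℂ) * z + 2 * (1 : ℝ)) * usqrt ((l : ℂ) * z + 2 * (1 : ℝ)))).im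
        = z.re * (a * b' + a' * b) + z.im * (a * b - a' * b') := by
  refine ⟨_, _, _, _, usqrt_re_nonneg ((k : ℂ) * z + 2 * (1 : ℝ)),
    usqrt_im_nonneg ((k : ℂ) * z + 2 * (1 : ℝ)), usqrt_re_nonneg ((l : ℂ) * z + 2 * (1 : ℝ)),
    usqrt_im_nonneg ((l : ℂ) * z + 2 * (1 : ℝ)), ?_, ?_, ?_, ?_, ?_⟩
  · rw [usqrt_re_sq_sub]; simp
  · rw [usqrt_re_mul_im]; simp [abs_of_nonneg hz, abs_of_pos hk]
  · rw [usqrt_re_sq_sub]; simp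
  · rw [usqrt_re_mul_im]; simp [abs_of_nonneg hz, abs_of_pos hl]
  · simp only [mul_im, mul_re]

lemma continuous_segmentIntegrand_im (z : ℂ) (κ : ℝ) :
    Continuous fun θ => (z * segmentIntegrand z κ θ).im :=
  Complex.continuous_im.comp (continuous_const.mul (continuous_segmentIntegrand_right z κ))

/-- The sign holds pointwise, by adding arguments. The first root has argument at least `π/4`.
Either `arg z ≥ 3π/4`, or `arg z > π/2` and the second root also has argument at least `π/4`; the
total lies strictly between `π` and `2π`. -/
lemma segmentPeriod_neg_of_left {z : ℂ} (hx : z.re ≤ -2) (hy : 0 < z.im)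
    (h : z.im ≤ -z.re ∨ z.re ≤ -8 / 3) : segmentPeriod 0 z 1 < 0 := by
  rw [segmentPeriod_zero_eq, ← neg_pos, ← intervalIntegral.integral_neg]
  refine intervalIntegral.intervalIntegral_pos_of_pos_on
    ((continuous_segmentIntegrand_im z 1).neg.intervalIntegrable _ _) ?_ (by positivity)
  intro θ hθ
  have hs : 0 < Real.sin θ := Real.sin_pos_of_pos_of_lt_pi hθ.1 (by linarith [hθ.2, Real.pi_pos])
  have hc : 0 < Real.cos θ := Real.cos_pos_of_mem_Ioo ⟨by linarith [hθ.1, Real.pi_pos], hθ.2⟩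
  have hc1 := Real.cos_le_one θ
  rw [segmentIntegrand_im, neg_pos]
  refine mul_neg_of_pos_of_neg (by positivity) ?_
  set c := Real.cos θ
  obtain ⟨a, a', b, b', ha, ha', hb, hb', h1, h2, h3, h4, h5⟩ := im_mul_usqrt_mul_usqrt z
    (1 + c + c ^ 2) (1 - c + c ^ 2) (by positivity) (by nlinarith) hy.le
  rw [h5]
  have h2' : 0 < a * a' := by have : 0 < (1 + c + c ^ 2) * z.im := by positivity
                              linarith
  have h4' : 0 < b * b' := by
    have : 0 < (1 - c + c ^ 2) * z.im := mul_pos (by nlinarith) hy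
    linarith
  have pa : 0 < a := pos_of_mul_pos_left h2' ha'
  have pa' : 0 < a' := pos_of_mul_pos_right h2' ha
  have pb : 0 < b := pos_of_mul_pos_left h4' hb'
  have pb' : 0 < b' := pos_of_mul_pos_right h4' hb
  have haa : a ≤ a' := by
    refine le_of_sq_le_sq ?_ ha'
    have : (1 + c + c ^ 2) * z.re ≤ 1 * z.re :=
      mul_le_mul_of_nonpos_right (by nlinarith) (by linarith)
    linarith
  have hcase : b ≤ b' ∨ z.im ≤ -z.re := by
    refine h.symm.imp_left fun h => le_of_sq_le_sq ?_ hb'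
    -- `3/4` is the minimum of `1 - c + c²`; hence the threshold `-8/3 = -2/(3/4)`.
    have : (1 - c + c ^ 2) * z.re ≤ 3 / 4 * z.re :=
      mul_le_mul_of_nonpos_right (by nlinarith [sq_nonneg (c - 1 / 2)]) (by linarith)
    linarith
  have e1 : 0 < a * b' := by positivity
  have e2 : 0 < a' * b := by positivity
  have f1 : z.re * (a * b' + a' * b) < z.re * (a' * b) :=
    mul_lt_mul_of_neg_left (by linarith) (by linarith)
  rcases hcase with hbb | hyx
  · have f2 : z.im * (a * b - a' * b') ≤ 0 :=
      mul_nonpos_of_nonneg_of_nonpos hy.le (sub_nonpos.mpr (mul_le_mul haa hbb hb ha'))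
    have f3 : z.re * (a' * b) ≤ 0 := mul_nonpos_of_nonpos_of_nonneg (by linarith) e2.le
    linarith
  · have f2 : a * b - a' * b' ≤ a' * b := by
      have := mul_le_mul_of_nonneg_right haa hb
      have := mul_pos pa' pb'
      linarith
    have f3 := mul_le_mul_of_nonneg_left f2 hy.le
    have f4 := mul_le_mul_of_nonneg_right hyx e2.le
    linarith

/-- Here `arg z ≤ π/2` and both roots have argument below `π/4`, so the total argument is below `π`.
-/
lemma segmentPeriod_pos_of_right {z : ℂ} (hx : 0 ≤ z.re) (hy : 0 < z.im) :
    0 < segmentPeriod 0 z 1 := by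
  rw [segmentPeriod_zero_eq]
  refine intervalIntegral.intervalIntegral_pos_of_pos_on
    ((continuous_segmentIntegrand_im z 1).intervalIntegrable _ _) ?_ (by positivity)
  intro θ hθ
  have hs : 0 < Real.sin θ := Real.sin_pos_of_pos_of_lt_pi hθ.1 (by linarith [hθ.2, Real.pi_pos])
  have hc : 0 < Real.cos θ := Real.cos_pos_of_mem_Ioo ⟨by linarith [hθ.1, Real.pi_pos], hθ.2⟩
  have hc1 := Real.cos_le_one θ
  rw [segmentIntegrand_im]
  refine mul_pos (by positivity) ?_
  set c := Real.cos θ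
  have hl : 0 < 1 - c + c ^ 2 := by nlinarith
  obtain ⟨a, a', b, b', ha, ha', hb, hb', h1, h2, h3, h4, h5⟩ := im_mul_usqrt_mul_usqrt z
    (1 + c + c ^ 2) (1 - c + c ^ 2) (by positivity) hl hy.le
  rw [h5]
  have haa : a' < a := by
    refine lt_of_pow_lt_pow_left₀ 2 ha ?_
    have : 0 ≤ (1 + c + c ^ 2) * z.re := by positivity
    linarith
  have hbb : b' < b := by
    refine lt_of_pow_lt_pow_left₀ 2 hb ?_
    have : 0 ≤ (1 - c + c ^ 2) * z.re := by positivity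
    linarith
  have f1 : 0 ≤ z.re * (a * b' + a' * b) := by positivity
  have f2 : 0 < z.im * (a * b - a' * b') :=
    mul_pos hy (sub_pos.mpr (mul_lt_mul'' haa hbb ha' hb'))
  linarith

/-- The first radicand is never positive, so the density is nonpositive. It is strictly negative at
`θ = π/3`, where `1 - c + c²` takes its minimum `3/4` and the second radicand is positive because
`z.re > -8/3`. -/
lemma segmentPeriod_neg_of_real {z : ℂ} (hx : z.re ≤ -2) (hx' : -8 / 3 < z.re) (hy : z.im = 0) :
    segmentPeriod 0 z 1 < 0 := by
  have hval : ∀ c ∈ Set.Icc (0 : ℝ) 1, ∃ a' b : ℝ, 0 ≤ a' ∧ 0 ≤ b ∧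
      (1 + c + c ^ 2) * z.re + 2 = -a' ^ 2 ∧
      ((1 - c + c ^ 2) * z.re + 2 ≤ b ^ 2) ∧
      (z * (usqrt (((1 + c + c ^ 2 : ℝ) : ℂ) * z + 2 * (1 : ℝ)) *
        usqrt (((1 - c + c ^ 2 : ℝ) : ℂ) * z + 2 * (1 : ℝ)))).im = z.re * (a' * b) := by
    intro c hc
    have hl : 0 < 1 - c + c ^ 2 := by nlinarith [hc.1, hc.2]
    have hc0 := hc.1
    obtain ⟨a, a', b, b', ha, ha', hb, hb', h1, h2, h3, h4, h5⟩ := im_mul_usqrt_mul_usqrt z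
      (1 + c + c ^ 2) (1 - c + c ^ 2) (by positivity) hl hy.ge
    have h2' : a * a' = 0 := by rw [hy] at h2; linarith
    have hk : (1 + c + c ^ 2) * z.re + 2 ≤ 0 := by
      have : (1 + c + c ^ 2) * z.re ≤ 1 * z.re :=
        mul_le_mul_of_nonpos_right (by nlinarith) (by linarith)
      linarith
    have ha0 : a = 0 := by
      rcases mul_eq_zero.mp h2' with h | h
      · exact h
      · rw [h] at h1
        have : a ^ 2 ≤ 0 := by linarith
        exact pow_eq_zero_iff two_ne_zero |>.mp (le_antisymm this (sq_nonneg a))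
    refine ⟨a', b, ha', hb, by rw [← h1, ha0]; ring, ?_, ?_⟩
    · rw [← h3]; linarith [sq_nonneg b']
    · rw [h5, hy, ha0]; ring
  rw [segmentPeriod_zero_eq, ← neg_pos, ← intervalIntegral.integral_neg]
  refine intervalIntegral.integral_pos (by positivity)
    (continuous_segmentIntegrand_im z 1).neg.continuousOn ?_ ⟨Real.pi / 3, ?_, ?_⟩
  · intro θ hθ
    have hc : 0 ≤ Real.cos θ :=
      Real.cos_nonneg_of_mem_Icc ⟨by linarith [hθ.1, Real.pi_pos], hθ.2⟩
    obtain ⟨a', b, ha', hb, -, -, h⟩ := hval _ ⟨hc, Real.cos_le_one θ⟩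
    rw [segmentIntegrand_im, h, neg_nonneg]
    exact mul_nonpos_of_nonneg_of_nonpos (by positivity)
      (mul_nonpos_of_nonpos_of_nonneg (by linarith) (by positivity))
  · constructor <;> linarith [Real.pi_pos]
  · obtain ⟨a', b, ha', hb, h1, h2, h⟩ := hval (1 / 2) ⟨by norm_num, by norm_num⟩
    rw [segmentIntegrand_im, Real.cos_pi_div_three, h, neg_pos]
    have hs : 0 < Real.sin (Real.pi / 3) :=
      Real.sin_pos_of_pos_of_lt_pi (by positivity) (by linarith [Real.pi_pos])
    have pa : 0 < a' := by
      refine lt_of_le_of_ne ha' fun h0 => ?_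
      rw [← h0] at h1
      norm_num at h1
      linarith
    have pb : 0 < b := by
      refine lt_of_le_of_ne hb fun h0 => ?_
      rw [← h0] at h2
      norm_num at h2
      linarith
    exact mul_neg_of_pos_of_neg (by positivity)
      (mul_neg_of_neg_of_pos (by linarith) (by positivity))

/-! ### Excluding a conjugate pair in the limit. -/

lemma sqrt_re_pos {z : ℂ} (hz : z ∈ slitPlane) : 0 < (Complex.sqrt z).re := by
  rw [Complex.sqrt, cpow_inv_two_re]
  refine Real.sqrt_pos.mpr ?_
  have h1 := abs_le.mp (abs_re_le_norm z)
  rcases lt_or_eq_of_le h1.1 with h | h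
  · linarith
  · exfalso
    have h2 := Complex.sq_norm z
    rw [normSq_apply] at h2
    have him : z.im = 0 := by
      have : ‖z‖ ^ 2 = z.re * z.re := by rw [← h]; ring
      nlinarith
    rcases mem_slitPlane_iff.mp hz with h3 | h3
    · linarith [norm_nonneg z]
    · exact h3 him

lemma norm_sqrt_le (z : ℂ) : ‖Complex.sqrt z‖ ≤ 1 + ‖z‖ := by
  have h : Complex.sqrt z ^ 2 = z := by simp [Complex.sqrt]
  have h2 : ‖Complex.sqrt z‖ ^ 2 = ‖z‖ := by rw [← norm_pow, h]
  nlinarith [sq_nonneg (‖Complex.sqrt z‖ - 1), norm_nonneg (Complex.sqrt z)]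

/-- The period over the segment between two zeros cannot be rotated to the imaginary axis in the
limit of a conjugate pair `p ± iq` in the left half plane and a real third root to the left of `p`. -/
lemma not_tendsto_conj_pair {U : Filter ℝ} [NeBot U] (hU : U ≤ 𝓝 0) {A r r' r'' : ℝ → ℂ}
    (hS : ∀ φ, SolvesBoutroux φ (A φ)) (h : ∀ φ, IsRootTriple (A φ) (r φ) (r' φ) (r'' φ))
    {p q x : ℝ} (hp : p < 0) (hq : q ≠ 0) (hx : x < p)
    (h1 : Tendsto r U (𝓝 (p + q * I))) (h2 : Tendsto r' U (𝓝 (p - q * I)))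
    (h3 : Tendsto r'' U (𝓝 x)) : False := by
  set K : Set ℝ := Set.Icc (-1) 1
  set W : ℂ × ℂ × ℂ → ℝ → ℂ := fun P τ => P.2.2 / (P.1 + P.2.1 * τ) - 1 with hW
  set P₀ : ℂ × ℂ × ℂ := (p, q * I, x) with hP₀
  have hP : Tendsto (fun φ => ((r φ + r' φ) / 2, (r φ - r' φ) / 2, r'' φ)) U (𝓝 P₀) := by
    refine Tendsto.prodMk_nhds ?_ (Tendsto.prodMk_nhds ?_ h3)
    · convert (h1.add h2).div_const 2 using 2; ring
    · convert (h1.sub h2).div_const 2 using 2; ring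
  have hne : ∀ τ : ℝ, P₀.1 + P₀.2.1 * τ ≠ 0 := by
    intro τ h0
    have := congrArg re h0
    simp [hP₀] at this
    linarith
  -- Along the segment `p + iqτ` the quotient `x/ζ` is real only at `τ = 0`, where `x/p > 1`.
  have hslit : ∀ τ : ℝ, W P₀ τ ∈ slitPlane := by
    intro τ
    rw [mem_slitPlane_iff]
    have hn : 0 < normSq (P₀.1 + P₀.2.1 * τ) := normSq_pos.mpr (hne τ)
    rcases eq_or_ne τ 0 with rfl | hτ
    · left
      simp only [hW, hP₀, ofReal_zero, mul_zero, add_zero, ← ofReal_div, sub_re, ofReal_re, one_re]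
      rw [sub_pos, one_lt_div_of_neg hp]
      exact hx
    · right
      have : (W P₀ τ).im = -(x * (q * τ)) / normSq (P₀.1 + P₀.2.1 * τ) := by
        simp [hW, hP₀, div_im]
        ring
      rw [this]
      refine div_ne_zero (neg_ne_zero.mpr ?_) hn.ne'
      have : x ≠ 0 := by linarith
      positivity
  have hWc : ∀ τ : ℝ, ContinuousAt (fun Q : (ℂ × ℂ × ℂ) × ℝ => W Q.1 Q.2) (P₀, τ) := by
    intro τ
    refine ContinuousAt.sub (ContinuousAt.div (by fun_prop) (by fun_prop) (hne τ))
      continuousAt_const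
  obtain ⟨B, hB⟩ : ∃ B, ∀ τ ∈ K, ‖W P₀ τ‖ ≤ B := by
    refine isCompact_Icc.exists_bound_of_continuousOn fun τ _ => ContinuousAt.continuousWithinAt ?_
    exact (hWc τ).comp (f := fun τ : ℝ => (P₀, τ)) (by fun_prop)
  have hev : ∀ᶠ P : ℂ × ℂ × ℂ in 𝓝 P₀, ∀ τ ∈ K,
      (P.1 + P.2.1 * (τ : ℂ) ≠ 0 ∧ W P τ ∈ slitPlane) ∧ ‖W P τ‖ < B + 1 := by
    refine isCompact_Icc.eventually_forall_of_forall_eventually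
      (P := fun (P : ℂ × ℂ × ℂ) (τ : ℝ) =>
        (P.1 + P.2.1 * (τ : ℂ) ≠ 0 ∧ W P τ ∈ slitPlane) ∧ ‖W P τ‖ < B + 1) fun τ hτ => ?_
    have e1 : ∀ᶠ Q : (ℂ × ℂ × ℂ) × ℝ in 𝓝 (P₀, τ), Q.1.1 + Q.1.2.1 * Q.2 ≠ 0 :=
      ContinuousAt.eventually_ne (by fun_prop) (hne τ)
    have e2 := (hWc τ).eventually (isOpen_slitPlane.mem_nhds (hslit τ))
    have e3 := (hWc τ).norm.eventually_lt (continuousAt_const (y := B + 1))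
      (by linarith [hB τ hτ])
    filter_upwards [e1, e2, e3] with Q q1 q2 q3 using ⟨⟨q1, q2⟩, q3⟩
  have hcos : ∀ t : ℝ, Real.cos (2 * Real.pi * t) ∈ K := fun t =>
    ⟨Real.neg_one_le_cos _, Real.cos_le_one _⟩
  set g : ℂ × ℂ × ℂ → ℝ → ℂ := fun P t => (Real.sin (2 * Real.pi * t) : ℂ) ^ 2 *
    Complex.sqrt (W P (Real.cos (2 * Real.pi * t))) with hg
  have hgc : ∀ t, ContinuousAt (fun Q : (ℂ × ℂ × ℂ) × ℝ => g Q.1 Q.2) (P₀, t) := by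
    intro t
    refine ContinuousAt.mul (by fun_prop) ?_
    have hc : ContinuousAt (fun Q : (ℂ × ℂ × ℂ) × ℝ => (Q.1, Real.cos (2 * Real.pi * Q.2)))
        (P₀, t) := by fun_prop
    have : ContinuousAt (fun Q : (ℂ × ℂ × ℂ) × ℝ => W Q.1 (Real.cos (2 * Real.pi * Q.2)))
        (P₀, t) := ContinuousAt.comp (x := (P₀, t)) (hWc (Real.cos (2 * Real.pi * t))) hc
    exact this.cpow continuousAt_const (hslit _)
  have hcont : ContinuousAt (fun P => ∫ t in (0 : ℝ)..1, g P t) P₀ := by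
    refine intervalIntegral.continuousAt_of_dominated_interval (bound := fun _ => 1 * (1 + (B + 1)))
      (Eventually.of_forall fun P => ?_) ?_ (by simp) (Eventually.of_forall fun t _ => ?_)
    · refine Measurable.aestronglyMeasurable ?_
      simp only [hg, hW, Complex.sqrt]
      fun_prop
    · filter_upwards [hev] with P hP
      refine Eventually.of_forall fun t _ => ?_
      rw [hg, norm_mul, norm_pow, norm_real, Real.norm_eq_abs]
      refine mul_le_mul ?_ ?_ (norm_nonneg _) zero_le_one
      · exact pow_le_one₀ (abs_nonneg _) (Real.abs_sin_le_one _)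
      · refine (norm_sqrt_le _).trans ?_
        linarith [(hP _ (hcos t)).2]
    · exact (hgc t).comp (f := fun P : ℂ × ℂ × ℂ => (P, t)) (by fun_prop)
  have hzero : ∀ᶠ φ in U, (exp (2 * I * φ) * (((r φ - r' φ) / 2) ^ 2 *
      ∫ t in (0 : ℝ)..1, g ((r φ + r' φ) / 2, (r φ - r' φ) / 2, r'' φ) t)).re = 0 := by
    filter_upwards [hP.eventually hev] with φ hφ
    refine (hS φ).re_period_root_root ?_ (fun τ hτ => (hφ τ hτ).1.1) fun τ hτ => (hφ τ hτ).1.2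
    intro z
    rw [(h φ).quartic]
    ring
  have hid : Tendsto (fun φ : ℝ => φ) U (𝓝 0) := hU
  have hexp : Tendsto (fun φ : ℝ => exp (2 * I * φ)) U (𝓝 1) := by
    have : Continuous fun φ : ℝ => exp (2 * I * φ) := by fun_prop
    simpa [Function.comp_def] using (this.tendsto 0).comp hid
  have hlim := (hexp.mul (((hP.snd_nhds.fst_nhds).pow 2).mul (hcont.tendsto.comp hP)))
  have hre := (Complex.continuous_re.tendsto _).comp hlim
  have heq := tendsto_nhds_unique (hre.congr' hzero) tendsto_const_nhds
  have hgc0 : Continuous (g P₀) := continuous_iff_continuousAt.mpr fun t =>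
    (hgc t).comp (f := fun t : ℝ => (P₀, t)) (by fun_prop)
  -- The principal root has positive real part off its cut, while `(iq)² = -q²` is real and nonzero,
  -- so the limiting period cannot be purely imaginary.
  have hpos : 0 < (∫ t in (0 : ℝ)..1, g P₀ t).re := by
    have := Complex.reCLM.intervalIntegral_comp_comm
      (hgc0.intervalIntegrable (μ := volume) 0 1)
    simp only [reCLM_apply] at this
    rw [← this]
    have hre : ∀ t, (g P₀ t).re = Real.sin (2 * Real.pi * t) ^ 2 *
        (Complex.sqrt (W P₀ (Real.cos (2 * Real.pi * t)))).re := fun t => by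
      simp only [hg]
      rw [← ofReal_pow, re_ofReal_mul]
    refine intervalIntegral.integral_pos one_pos
      (Complex.continuous_re.comp hgc0).continuousOn (fun t _ => ?_) ⟨1 / 4, by norm_num, ?_⟩
    · rw [hre]
      exact mul_nonneg (sq_nonneg _) (sqrt_re_pos (hslit _)).le
    · rw [hre, show 2 * Real.pi * (1 / 4) = Real.pi / 2 by ring, Real.sin_pi_div_two]
      exact mul_pos (by norm_num) (sqrt_re_pos (hslit _))
  have : (q * I : ℂ) ^ 2 = ((-q ^ 2 : ℝ) : ℂ) := by rw [mul_pow, I_sq]; push_cast; ring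
  simp only [hP₀, this, one_mul, re_ofReal_mul, mul_eq_zero, neg_eq_zero] at heq
  rcases heq with h | h
  · exact hq (pow_eq_zero_iff two_ne_zero |>.mp h)
  · exact hpos.ne' h

/-! ### Compactness: the zeros converge to those of the degenerate curve. -/

lemma Ultrafilter.exists_tendsto_of_norm_le (U : Ultrafilter ℝ) {f : ℝ → ℂ} {C : ℝ}
    (hf : ∀ x, ‖f x‖ ≤ C) : ∃ z, Tendsto f U (𝓝 z) := by
  obtain ⟨z, -, hz⟩ := (isCompact_closedBall (0 : ℂ) C).ultrafilter_le_nhds' (U.map f)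
    (Ultrafilter.mem_map.mpr (Filter.univ_mem' fun x => by simpa using hf x))
  exact ⟨z, hz⟩

/-- At `κ = 0` both radicands are positive multiples of `z`, so the period is a positive multiple of
`Im z²`. -/
lemma segmentPeriod_zero_scale (z : ℂ) (hz : 0 ≤ z.im) :
    ∃ K : ℝ, 0 < K ∧ segmentPeriod 0 z 0 = K * (z.re * z.im) := by
  set f : ℝ → ℝ := fun θ => Real.sin θ ^ 2 *
    (√(1 + Real.cos θ + Real.cos θ ^ 2) * √(1 - Real.cos θ + Real.cos θ ^ 2)) with hf
  have hfc : Continuous f := by simp only [hf]; fun_prop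
  refine ⟨2 * ∫ θ in (0 : ℝ)..(Real.pi / 2), f θ, ?_, ?_⟩
  · refine mul_pos two_pos (intervalIntegral.intervalIntegral_pos_of_pos_on
      (hfc.intervalIntegrable _ _) (fun θ hθ => ?_) (by positivity))
    have hs : 0 < Real.sin θ :=
      Real.sin_pos_of_pos_of_lt_pi hθ.1 (by linarith [hθ.2, Real.pi_pos])
    have h1 : 0 < 1 + Real.cos θ + Real.cos θ ^ 2 := by nlinarith [sq_nonneg (Real.cos θ + 1 / 2)]
    have h2 : 0 < 1 - Real.cos θ + Real.cos θ ^ 2 := by nlinarith [sq_nonneg (Real.cos θ - 1 / 2)]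
    simp only [hf]
    positivity
  · rw [segmentPeriod_zero_eq, mul_comm 2, mul_assoc, ← intervalIntegral.integral_mul_const]
    refine intervalIntegral.integral_congr fun θ _ => ?_
    have h1 : 0 ≤ 1 + Real.cos θ + Real.cos θ ^ 2 := by nlinarith [sq_nonneg (Real.cos θ + 1 / 2)]
    have h2 : 0 ≤ 1 - Real.cos θ + Real.cos θ ^ 2 := by nlinarith [sq_nonneg (Real.cos θ - 1 / 2)]
    simp only [segmentIntegrand_im, ofReal_zero, mul_zero, add_zero]
    rw [usqrt_ofReal_mul h1, usqrt_ofReal_mul h2, mul_mul_mul_comm, ← pow_two (usqrt z),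
      usqrt_sq hz, ← ofReal_mul, mul_left_comm, im_ofReal_mul, mul_im]
    simp only [hf]
    ring

/-- Each number lies on a coordinate axis. One that is alone on its axis vanishes because the sum
does; the squares of those left have one sign and sum to zero. -/
lemma eq_zero_of_re_mul_im_eq_zero {z z' z'' : ℂ} (h : z.re * z.im = 0) (h' : z'.re * z'.im = 0)
    (h'' : z''.re * z''.im = 0) (hsum : z + z' + z'' = 0)
    (hmul : z * z' + z * z'' + z' * z'' = 0) : z = 0 ∧ z' = 0 ∧ z'' = 0 := by
  have s1 := congrArg re hsum
  have s2 := congrArg im hsum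
  have hsq : z ^ 2 + z' ^ 2 + z'' ^ 2 = 0 := by linear_combination (z + z' + z'') * hsum - 2 * hmul
  have s3 := congrArg re hsq
  simp [pow_two] at s1 s2 s3
  have key : normSq z + normSq z' + normSq z'' = 0 := by
    simp only [normSq_apply]
    rcases mul_eq_zero.mp h with h | h <;> rcases mul_eq_zero.mp h' with h' | h' <;>
      rcases mul_eq_zero.mp h'' with h'' | h'' <;>
      simp only [h, h', h'', mul_zero, zero_add, add_zero, zero_sub, sub_zero] at s1 s2 s3 ⊢ <;>
      first
      | linarith
      | (rw [s1] at s3 ⊢; linarith)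
      | (rw [s2] at s3 ⊢; linarith)
  have n1 := normSq_nonneg z
  have n2 := normSq_nonneg z'
  have n3 := normSq_nonneg z''
  exact ⟨normSq_eq_zero.mp (by linarith), normSq_eq_zero.mp (by linarith),
    normSq_eq_zero.mp (by linarith)⟩

/-- The region containing the leftmost zero. -/
lemma leftmost_root_region {A r r' r'' : ℂ} (h : IsRootTriple A r r' r'') (h1 : r''.re ≤ r.re)
    (h2 : r''.re ≤ r'.re) :
    (r''.im ≠ 0 ∧ r''.re < -2 ∧ r''.im ^ 2 ≤ (3 * r''.re + 2) * (r''.re + 2)) ∨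
    (r''.im = 0 ∧ r''.re ≤ -2 ∧ -8 / 3 < r''.re) ∨
    (r'' = -8 / 3 ∧ r = -2 / 3 ∧ r' = -2 / 3) ∨
    (r''.im = 0 ∧ r''.re < -8 / 3 ∧ r.re = r'.re ∧ r.im = -r'.im ∧ r.im ≠ 0) := by
  have hΔ : (r - r') ^ 2 = -3 * r'' ^ 2 - 8 * r'' := by
    have e1 : r + r' = -4 - r'' := by linear_combination h.sum
    have e2 : r * r' = 4 + 4 * r'' + r'' ^ 2 := by linear_combination h.sum_mul - r'' * e1
    linear_combination (r + r' - 4 - r'') * e1 - 4 * e2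
  have hs1 := congrArg re h.sum
  have hs2 := congrArg im h.sum
  have hd1 := congrArg re hΔ
  have hd2 := congrArg im hΔ
  simp [pow_two] at hs1 hs2 hd1 hd2
  set x := r''.re with hx
  set y := r''.im with hy
  set e := r.re - r'.re with he
  set f := r.im - r'.im with hf
  have hx1 : 3 * x + 4 ≤ 0 := by linarith
  -- This is where leftmost enters: `(r.re - x)(r'.re - x) ≥ 0`, with the sum of the two real parts
  -- equal to `-4 - x`. With `e f = -y(3x + 4)` it yields `|y| ≤ |f|` when `y ≠ 0`.
  have he2 : e ^ 2 ≤ (3 * x + 4) ^ 2 := by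
    have := mul_nonneg (sub_nonneg.mpr h1) (sub_nonneg.mpr h2)
    have h3 : r.re + r'.re = -4 - x := by linarith
    have : e ^ 2 = (-4 - x) ^ 2 - 4 * (r.re * r'.re) := by rw [← h3, he]; ring
    nlinarith
  have hef : e * f = -(y * (3 * x + 4)) := by linarith
  have hef2 : e ^ 2 - f ^ 2 = -3 * (x ^ 2 - y ^ 2) - 8 * x := by linarith
  by_cases hy0 : y = 0
  · right
    rw [hy0] at hef hef2
    have hef' : e = 0 ∨ f = 0 := by simpa using hef
    rcases lt_trichotomy x (-8 / 3) with hlt | heq | hgt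
    · right; right
      have he0 : e = 0 := by
        rcases hef' with h | h
        · exact h
        · rw [h] at hef2
          nlinarith
      refine ⟨hy0, hlt, by linarith, by linarith, fun h0 => ?_⟩
      have hf0 : f = 0 := by linarith
      rw [he0, hf0] at hef2
      nlinarith
    · right; left
      have hef3 : e ^ 2 = f ^ 2 := by rw [heq] at hef2; linarith
      have hboth : e = 0 ∧ f = 0 := by
        rcases hef' with h | h
        · exact ⟨h, pow_eq_zero_iff two_ne_zero |>.mp (by rw [← hef3, h]; ring)⟩
        · exact ⟨pow_eq_zero_iff two_ne_zero |>.mp (by rw [hef3, h]; ring), h⟩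
      refine ⟨?_, ?_, ?_⟩ <;> apply Complex.ext <;> simp <;> linarith [hboth.1, hboth.2]
    · left
      refine ⟨hy0, ?_, hgt⟩
      have hf0 : f = 0 := by
        rcases hef' with h | h
        · rw [h] at hef2
          nlinarith [sq_nonneg f]
        · exact h
      rw [hf0] at hef2
      nlinarith
  · left
    have hlt : 3 * x + 4 < 0 := by
      refine lt_of_le_of_ne hx1 fun h0 => ?_
      have : e = 0 := by rw [h0] at he2; nlinarith
      have hx4 : x = -4 / 3 := by linarith
      rw [this, hx4] at hef2
      nlinarith [sq_nonneg f, sq_nonneg y]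
    have hfy : y ^ 2 ≤ f ^ 2 := by
      have h3 : e ^ 2 * f ^ 2 = y ^ 2 * (3 * x + 4) ^ 2 := by
        rw [← mul_pow, hef]; ring
      have h4 : y ^ 2 * (3 * x + 4) ^ 2 ≤ f ^ 2 * (3 * x + 4) ^ 2 := by
        rw [← h3, mul_comm]
        exact mul_le_mul_of_nonneg_left he2 (sq_nonneg f)
      exact le_of_mul_le_mul_right h4 (sq_pos_of_neg hlt)
    have hreg : y ^ 2 ≤ (3 * x + 2) * (x + 2) := by nlinarith
    have hy2 : 0 < y ^ 2 := by positivity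
    refine ⟨hy0, ?_, hreg⟩
    by_contra hge
    push Not at hge
    nlinarith

theorem tendsto_roots {A r r' r'' : ℝ → ℂ} (hS : ∀ φ, SolvesBoutroux φ (A φ))
    (h : ∀ φ, IsRootTriple (A φ) (r φ) (r' φ) (r'' φ)) (h1 : ∀ φ, (r'' φ).re ≤ (r φ).re)
    (h2 : ∀ φ, (r'' φ).re ≤ (r' φ).re) :
    Tendsto (fun φ => (r φ, r' φ, r'' φ)) (𝓝 0) (𝓝 (-2 / 3, -2 / 3, -8 / 3)) := by
  rw [tendsto_iff_ultrafilter]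
  intro U hU
  -- With this scale the norms of `1/R` and of the three scaled zeros sum to `1`, so the limits
  -- cannot all vanish; `k = lim 1/R` is zero exactly when the zeros escape to infinity.
  set R : ℝ → ℝ := fun φ => 1 + ‖r φ‖ + ‖r' φ‖ + ‖r'' φ‖ with hR
  have hRpos : ∀ φ, 0 < R φ := fun φ => by positivity
  have hbd : ∀ s : ℝ → ℂ, (∀ φ, ‖s φ‖ ≤ R φ) → ∀ φ, ‖s φ / R φ‖ ≤ 1 := by
    intro s hs φ
    rw [norm_div, norm_real, Real.norm_eq_abs, abs_of_pos (hRpos φ)]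
    exact div_le_one_of_le₀ (hs φ) (hRpos φ).le
  have hb := fun φ => And.intro (norm_nonneg (r φ)) (And.intro (norm_nonneg (r' φ))
    (norm_nonneg (r'' φ)))
  obtain ⟨z, hz⟩ := U.exists_tendsto_of_norm_le (hbd r fun φ => by
    simp only [hR]; linarith [hb φ])
  obtain ⟨z', hz'⟩ := U.exists_tendsto_of_norm_le (hbd r' fun φ => by
    simp only [hR]; linarith [hb φ])
  obtain ⟨z'', hz''⟩ := U.exists_tendsto_of_norm_le (hbd r'' fun φ => by
    simp only [hR]; linarith [hb φ])
  obtain ⟨k, hk⟩ := U.exists_tendsto_of_norm_le (hbd (fun _ => 1) fun φ => by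
    simp only [hR, norm_one]; linarith [hb φ])
  have hκ : Tendsto (fun φ => 1 / R φ) U (𝓝 k.re) := by
    convert (Complex.continuous_re.tendsto k).comp hk using 2
    simp [← ofReal_one, ← ofReal_div]
  have hk' : (k.re : ℂ) = k := by
    refine tendsto_nhds_unique (f := fun φ => (1 : ℂ) / R φ) ?_ hk
    convert (Complex.continuous_ofReal.tendsto _).comp hκ using 2
    simp
  have hsum : z + z' + z'' = -4 * k := by
    refine tendsto_nhds_unique ((hz.add hz').add hz'') ((hk.const_mul (-4)).congr fun φ => ?_)
    rw [← (h φ).sum]; ring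
  have hmul : z * z' + z * z'' + z' * z'' = 4 * (k * k) := by
    refine tendsto_nhds_unique (((hz.mul hz').add (hz.mul hz'')).add (hz'.mul hz''))
      (((hk.mul hk).const_mul 4).congr fun φ => ?_)
    rw [← (h φ).sum_mul]; ring
  rcases eq_or_ne k 0 with hk0 | hk0
  · exfalso
    have hnorm : ‖k‖ + ‖z‖ + ‖z'‖ + ‖z''‖ = 1 := by
      refine tendsto_nhds_unique (((hk.norm.add hz.norm).add hz'.norm).add hz''.norm)
        (tendsto_const_nhds.congr fun φ => ?_)
      simp only [norm_div, norm_real, Real.norm_eq_abs, abs_of_pos (hRpos φ), norm_one,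
        ← add_div]
      exact (div_self (hRpos φ).ne').symm
    have hzero : ∀ {s s' s'' : ℝ → ℂ} {w : ℂ},
        (∀ φ, IsRootTriple (A φ) (s φ) (s' φ) (s'' φ)) →
        Tendsto (fun φ => s φ / R φ) U (𝓝 w) → w.re * w.im = 0 := by
      intro s s' s'' w hs hw
      have := segmentPeriod_limit hU hS hs hRpos hw hκ
      rw [hk0, zero_re] at this
      obtain ⟨K, hK, hK'⟩ := segmentPeriod_zero_scale (reflectUp w) (abs_nonneg _)
      rw [hK', mul_eq_zero] at this
      simpa [hK.ne', reflectUp] using this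
    obtain ⟨e1, e2, e3⟩ := eq_zero_of_re_mul_im_eq_zero (hzero h hz)
      (hzero (fun φ => (h φ).swap) hz') (hzero (fun φ => (h φ).rotate) hz'')
      (by rw [hsum, hk0, mul_zero]) (by rw [hmul, hk0]; ring)
    simp [e1, e2, e3, hk0] at hnorm
  have hunscale : ∀ {s : ℝ → ℂ} {w : ℂ}, Tendsto (fun φ => s φ / R φ) U (𝓝 w) →
      Tendsto s U (𝓝 (w / k)) := by
    intro s w hw
    refine (hw.div hk hk0).congr fun φ => ?_
    have : (R φ : ℂ) ≠ 0 := by exact_mod_cast (hRpos φ).ne'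
    simp only [Pi.div_apply]
    field_simp
  have l1 := hunscale hz
  have l2 := hunscale hz'
  have l3 := hunscale hz''
  set a := z / k
  set a' := z' / k
  set a'' := z'' / k
  have hperiod : ∀ {s s' s'' : ℝ → ℂ} {w : ℂ},
      (∀ φ, IsRootTriple (A φ) (s φ) (s' φ) (s'' φ)) →
      Tendsto s U (𝓝 w) → segmentPeriod 0 (reflectUp w) 1 = 0 := by
    intro s s' s'' w hs hw
    exact segmentPeriod_limit hU hS hs (R := fun _ => 1) (fun _ => one_pos) (by simpa using hw)
      (by simp)
  have ht : IsRootTriple (-(a * a' * a'') / 4) a a' a'' := by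
    refine ⟨?_, ?_, by ring⟩
    · exact tendsto_nhds_unique ((l1.add l2).add l3)
        (tendsto_const_nhds.congr fun φ => (h φ).sum.symm)
    · exact tendsto_nhds_unique (((l1.mul l2).add (l1.mul l3)).add (l2.mul l3))
        (tendsto_const_nhds.congr fun φ => (h φ).sum_mul.symm)
  have o1 : a''.re ≤ a.re := le_of_tendsto_of_tendsto' ((Complex.continuous_re.tendsto _).comp l3)
    ((Complex.continuous_re.tendsto _).comp l1) h1
  have o2 : a''.re ≤ a'.re := le_of_tendsto_of_tendsto' ((Complex.continuous_re.tendsto _).comp l3)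
    ((Complex.continuous_re.tendsto _).comp l2) h2
  rcases leftmost_root_region ht o1 o2 with ⟨c1, c2, c3⟩ | ⟨c1, c2, c3⟩ | ⟨c1, c2, c3⟩ |
    ⟨c1, c2, c3, c4, c5⟩
  · exfalso
    refine (segmentPeriod_neg_of_left (z := reflectUp a'') c2.le (abs_pos.mpr c1) ?_).ne
      (hperiod (fun φ => (h φ).rotate) l3)
    -- If `-8/3 < x < -2`, then `(3x + 2)(x + 2) < x²`, because the difference is `2((x + 2)² - 2)`;
    -- so the region forces `|y| < -x`.
    simp only [reflectUp]
    by_contra hcon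
    push Not at hcon
    have := sq_abs a''.im
    nlinarith
  · exfalso
    exact (segmentPeriod_neg_of_real (z := reflectUp a'') c2 c3 (by simp [reflectUp, c1])).ne
      (hperiod (fun φ => (h φ).rotate) l3)
  · rw [c2] at l1
    rw [c3] at l2
    rw [c1] at l3
    exact l1.prodMk_nhds (l2.prodMk_nhds l3)
  · exfalso
    rcases le_or_gt 0 a.re with hp | hp
    · exact (segmentPeriod_pos_of_right (z := reflectUp a) hp (abs_pos.mpr c5)).ne'
        (hperiod h l1)
    · refine not_tendsto_conj_pair hU hS h (p := a.re) (q := a.im) (x := a''.re) hp c5 ?_ ?_ ?_ ?_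
      · have := congrArg re ht.sum
        simp at this
        linarith
      · rwa [re_add_im]
      · have : (a.re : ℂ) - a.im * I = a' := by
          apply Complex.ext <;> simp [c3, c4]
        rwa [this]
      · have : (a''.re : ℂ) = a'' := by apply Complex.ext <;> simp [c1]
        rwa [this]

/-! ### Estimates for the principal square root. -/

lemma sqrt_sq_eq (z : ℂ) : Complex.sqrt z ^ 2 = z := by simp [Complex.sqrt]

lemma sqrt_re_nonneg (z : ℂ) : 0 ≤ (Complex.sqrt z).re := by
  rw [Complex.sqrt, cpow_inv_two_re]; exact Real.sqrt_nonneg _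

lemma sqrt_re_sq_sub (z : ℂ) : (Complex.sqrt z).re ^ 2 - (Complex.sqrt z).im ^ 2 = z.re := by
  conv_rhs => rw [← sqrt_sq_eq z]
  simp [pow_two]

lemma norm_sqrt_sq (z : ℂ) : ‖Complex.sqrt z‖ ^ 2 = ‖z‖ := by rw [← norm_pow, sqrt_sq_eq]

lemma sqrt_ofReal' {x : ℝ} (hx : 0 ≤ x) : Complex.sqrt (x : ℂ) = (√x : ℝ) := by
  rw [Complex.sqrt_of_nonneg (by exact_mod_cast hx), ofReal_re]

lemma continuousOn_sqrt_re_nonneg : ContinuousOn Complex.sqrt {z : ℂ | 0 ≤ z.re} := by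
  intro z hz
  refine ContinuousAt.continuousWithinAt ?_
  rcases eq_or_ne z 0 with rfl | h0
  · rw [ContinuousAt, Complex.sqrt_zero, tendsto_zero_iff_norm_tendsto_zero]
    have : Tendsto (fun z : ℂ => √‖z‖) (𝓝 0) (𝓝 0) := by
      have : Continuous fun z : ℂ => √‖z‖ := by fun_prop
      simpa using this.tendsto 0
    refine this.congr fun z => ?_
    rw [← norm_sqrt_sq, Real.sqrt_sq (norm_nonneg _)]
  · refine continuousAt_cpow_const ?_
    rw [mem_slitPlane_iff]
    rcases lt_or_eq_of_le (show 0 ≤ z.re from hz) with h | h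
    · exact Or.inl h
    · exact Or.inr fun h' => h0 (Complex.ext h.symm h')

/-- Difference of squares: `Re √a ≥ 0` and `Re √b ≥ 1/2`, so `√a + √b` stays away from `0` even if
`a` is on the cut. -/
lemma norm_sqrt_sub_sqrt_le (a : ℂ) {b : ℂ} (hb : 1 / 4 ≤ b.re) :
    ‖Complex.sqrt a - Complex.sqrt b‖ ≤ 2 * ‖a - b‖ := by
  have h1 : (a - b) = (Complex.sqrt a - Complex.sqrt b) * (Complex.sqrt a + Complex.sqrt b) := by
    conv_lhs => rw [← sqrt_sq_eq a, ← sqrt_sq_eq b]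
    ring
  have h2 : 1 / 2 ≤ (Complex.sqrt b).re := by
    refine le_of_sq_le_sq ?_ (sqrt_re_nonneg b)
    nlinarith [sqrt_re_sq_sub b, sq_nonneg (Complex.sqrt b).im]
  have h3 : 1 / 2 ≤ ‖Complex.sqrt a + Complex.sqrt b‖ := by
    refine le_trans ?_ (re_le_norm _)
    rw [add_re]
    linarith [sqrt_re_nonneg a]
  rw [h1, norm_mul]
  nlinarith [norm_nonneg (Complex.sqrt a - Complex.sqrt b)]

/-- If two complex numbers lie in the sector `|arg| ≤ π/4`, there is no cancellation in their
sum. -/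
lemma norm_sq_add_norm_sq_le {a b : ℂ} (ha : 0 ≤ a.re) (hb : 0 ≤ b.re)
    (ha' : a.im ^ 2 ≤ a.re ^ 2) (hb' : b.im ^ 2 ≤ b.re ^ 2) :
    ‖a‖ ^ 2 + ‖b‖ ^ 2 ≤ ‖a + b‖ ^ 2 := by
  have h : |a.im * b.im| ≤ a.re * b.re := by
    rw [abs_mul]
    exact mul_le_mul (abs_le_of_sq_le_sq ha' ha) (abs_le_of_sq_le_sq hb' hb) (abs_nonneg _) ha
  have := (abs_le.mp h).1
  simp only [Complex.sq_norm, normSq_apply, add_re, add_im]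
  nlinarith

/-! ### The cycle around the two colliding zeros. -/

/-- The period is a constant times `d² ∫ sin² √(r/ζ - 1)`, and this root is `√3 + O(|d|)`; the
integral is therefore `√3/2 + O(|d|)`. -/
lemma SolvesBoutroux.abs_re_le {φ : ℝ} {A d μ : ℂ} (hS : SolvesBoutroux φ A)
    (h : IsRootTriple A (-2 / 3 + μ + d) (-2 / 3 + μ - d) (-8 / 3 - 2 * μ))
    (hd : ‖d‖ ≤ 1 / 100) (hμ : ‖μ‖ ≤ ‖d‖ ^ 2) :
    |(exp (2 * I * φ) * d ^ 2).re| ≤ 24 * ‖d‖ ^ 3 := by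
  have hd0 := norm_nonneg d
  have hμ' : ‖μ‖ ≤ ‖d‖ / 100 := by nlinarith
  set W : ℝ → ℂ := fun x => (-8 / 3 - 2 * μ) / (-2 / 3 + μ + d * x) - 1 with hW
  have hlow : ∀ x ∈ Set.Icc (-1 : ℝ) 1, 1 / 2 ≤ ‖-2 / 3 + μ + d * (x : ℂ)‖ := by
    intro x hx
    have e1 : ‖d * (x : ℂ)‖ ≤ ‖d‖ := by
      rw [norm_mul, norm_real, Real.norm_eq_abs]
      exact mul_le_of_le_one_right hd0 (abs_le.mpr hx)
    have e2 : ‖(-2 / 3 : ℂ)‖ = 2 / 3 := by norm_num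
    have e3 := norm_sub_le (-2 / 3 + μ + d * (x : ℂ)) (μ + d * (x : ℂ))
    rw [show -2 / 3 + μ + d * (x : ℂ) - (μ + d * (x : ℂ)) = (-2 / 3 : ℂ) by ring, e2] at e3
    linarith [norm_add_le μ (d * (x : ℂ))]
  have hWn : ∀ x ∈ Set.Icc (-1 : ℝ) 1, ‖W x - 3‖ ≤ 9 * ‖d‖ := by
    intro x hx
    have hl := hlow x hx
    have hne : -2 / 3 + μ + d * (x : ℂ) ≠ 0 := norm_pos_iff.mp (by linarith)
    have e1 : ‖d * (x : ℂ)‖ ≤ ‖d‖ := by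
      rw [norm_mul, norm_real, Real.norm_eq_abs]
      exact mul_le_of_le_one_right hd0 (abs_le.mpr hx)
    have : W x - 3 = -(6 * μ + 4 * (d * (x : ℂ))) / (-2 / 3 + μ + d * (x : ℂ)) := by
      simp only [hW]
      rw [eq_div_iff hne, sub_mul, sub_mul, div_mul_cancel₀ _ hne]
      ring
    rw [this, norm_div, norm_neg, div_le_iff₀ (by linarith)]
    have e4 := norm_add_le (6 * μ) (4 * (d * (x : ℂ)))
    rw [norm_mul, norm_mul 4] at e4
    simp only [Complex.norm_ofNat] at e4
    nlinarith
  have hWre : ∀ x ∈ Set.Icc (-1 : ℝ) 1, 2 ≤ (W x).re := by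
    intro x hx
    have e1 := hWn x hx
    have e2 := (abs_le.mp ((abs_re_le_norm (W x - 3)).trans e1)).1
    simp at e2
    linarith
  have key := hS.re_period_root_root (fun z => by rw [h.quartic])
    (fun x hx => norm_pos_iff.mp (by linarith [hlow x hx]))
    (fun x hx => mem_slitPlane_iff.mpr
      (Or.inl (show 0 < (W x).re by linarith [hWre x hx])))
  have hmem : ∀ t : ℝ, Real.cos (2 * Real.pi * t) ∈ Set.Icc (-1 : ℝ) 1 := fun t =>
    ⟨Real.neg_one_le_cos _, Real.cos_le_one _⟩
  set Φ := ∫ t in (0 : ℝ)..1, (Real.sin (2 * Real.pi * t) : ℂ) ^ 2 *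
      Complex.sqrt (W (Real.cos (2 * Real.pi * t))) with hΦ
  have hsin : ∫ t in (0 : ℝ)..1, (Real.sin (2 * Real.pi * t) : ℂ) ^ 2 * (√3 : ℝ)
      = (√3 / 2 : ℝ) := by
    have e1 : ∫ t in (0 : ℝ)..1, Real.sin (2 * Real.pi * t) ^ 2 = 1 / 2 := by
      rw [intervalIntegral.integral_comp_mul_left (fun x => Real.sin x ^ 2) (by positivity),
        integral_sin_sq]
      simp [Real.sin_two_pi]
      field_simp
    have e2 : ∫ t in (0 : ℝ)..1, (Real.sin (2 * Real.pi * t) : ℂ) ^ 2 * (√3 : ℝ)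
        = ((∫ t in (0 : ℝ)..1, Real.sin (2 * Real.pi * t) ^ 2 * √3 : ℝ) : ℂ) := by
      rw [← intervalIntegral.integral_ofReal]
      push_cast
      rfl
    rw [e2, intervalIntegral.integral_mul_const, e1]
    congr 1; ring
  have hsub : ‖Φ - (√3 / 2 : ℝ)‖ ≤ 18 * ‖d‖ := by
    have hcW : Continuous fun t : ℝ => W (Real.cos (2 * Real.pi * t)) := by
      simp only [hW]
      refine Continuous.sub (Continuous.div (by fun_prop) (by fun_prop) fun t => ?_)
        continuous_const
      exact norm_pos_iff.mp (by linarith [hlow _ (hmem t)])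
    have hcs : Continuous fun t : ℝ => Complex.sqrt (W (Real.cos (2 * Real.pi * t))) :=
      continuousOn_sqrt_re_nonneg.comp_continuous hcW fun t => by
        have := hWre _ (hmem t)
        show (0 : ℝ) ≤ _; linarith
    rw [← hsin, hΦ, ← intervalIntegral.integral_sub
      (Continuous.intervalIntegrable (by fun_prop) _ _)
      (Continuous.intervalIntegrable (by fun_prop) _ _)]
    have := intervalIntegral.norm_integral_le_of_norm_le_const (a := (0 : ℝ)) (b := 1)
      (C := 18 * ‖d‖) (f := fun t => (Real.sin (2 * Real.pi * t) : ℂ) ^ 2 *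
        Complex.sqrt (W (Real.cos (2 * Real.pi * t))) -
        (Real.sin (2 * Real.pi * t) : ℂ) ^ 2 * (√3 : ℝ)) fun t _ => ?_
    · simpa using this
    · rw [← mul_sub, norm_mul, norm_pow, norm_real, Real.norm_eq_abs]
      have e1 : |Real.sin (2 * Real.pi * t)| ^ 2 ≤ 1 :=
        pow_le_one₀ (abs_nonneg _) (Real.abs_sin_le_one _)
      have e2 := norm_sqrt_sub_sqrt_le (W (Real.cos (2 * Real.pi * t))) (b := (3 : ℝ))
        (by norm_num)
      rw [sqrt_ofReal' (by norm_num)] at e2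
      have e3 := hWn _ (hmem t)
      push_cast at e2
      nlinarith [norm_nonneg (Complex.sqrt (W (Real.cos (2 * Real.pi * t))) - (√3 : ℝ))]
  set w := exp (2 * I * φ) * d ^ 2 with hw
  have hwn : ‖w‖ = ‖d‖ ^ 2 := by
    rw [hw, norm_mul, norm_pow, show 2 * I * (φ : ℂ) = ((2 * φ : ℝ) : ℂ) * I by push_cast; ring,
      norm_exp_ofReal_mul_I, one_mul]
  have e1 : w.re * (√3 / 2) = -(w * (Φ - (√3 / 2 : ℝ))).re := by
    rw [← mul_assoc, ← hw] at key
    rw [mul_sub, sub_re, key, re_mul_ofReal]; ring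
  have e2 : |w.re| * (√3 / 2) ≤ ‖d‖ ^ 2 * (18 * ‖d‖) := by
    have hs3 : (0 : ℝ) ≤ √3 / 2 := by positivity
    rw [← abs_of_nonneg hs3, ← abs_mul, e1, abs_neg]
    refine (abs_re_le_norm _).trans ?_
    rw [norm_mul, hwn]
    gcongr
  -- This bounds `18 / (√3/2)` by the constant `24`.
  have e3 : (3 : ℝ) / 2 ≤ √3 := Real.le_sqrt_of_sq_le (by norm_num)
  nlinarith [abs_nonneg w.re]

/-! ### Logarithmic expansion of the period from `0` to a colliding zero. -/

/-- The model kernel that produces `log ‖d‖`, with `δ = ‖d‖`. -/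
lemma integral_sin_mul_cos_div {δ : ℝ} (hδ : 0 < δ) :
    ∫ θ in (0 : ℝ)..(Real.pi / 2), Real.sin θ * Real.cos θ / (Real.sin θ ^ 2 + δ)
      = (Real.log (1 + δ) - Real.log δ) / 2 := by
  have hder : ∀ θ : ℝ, HasDerivAt (fun θ => Real.log (Real.sin θ ^ 2 + δ) / 2)
      (Real.sin θ * Real.cos θ / (Real.sin θ ^ 2 + δ)) θ := by
    intro θ
    have h0 : Real.sin θ ^ 2 + δ ≠ 0 := by positivity
    have := ((((Real.hasDerivAt_sin θ).pow 2).add_const δ).log h0).div_const 2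
    convert! this using 1
    simp; ring
  rw [intervalIntegral.integral_eq_sub_of_hasDerivAt (fun θ _ => hder θ)]
  · simp; ring
  · refine Continuous.intervalIntegrable ?_ _ _
    exact Continuous.div (by fun_prop) (by fun_prop) fun θ => by positivity

/-- The error kernel: its integral is bounded uniformly in `δ`. -/
lemma integral_sin_mul_cos_div_sq_le {δ : ℝ} (hδ : 0 < δ) :
    ∫ θ in (0 : ℝ)..(Real.pi / 2), Real.sin θ * Real.cos θ * δ / (Real.sin θ ^ 2 + δ) ^ 2
      ≤ 1 / 2 := by
  have hder : ∀ θ : ℝ, HasDerivAt (fun θ => -(δ / 2) * (Real.sin θ ^ 2 + δ)⁻¹)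
      (Real.sin θ * Real.cos θ * δ / (Real.sin θ ^ 2 + δ) ^ 2) θ := by
    intro θ
    have h0 : Real.sin θ ^ 2 + δ ≠ 0 := by positivity
    have := ((((Real.hasDerivAt_sin θ).pow 2).add_const δ).inv h0).const_mul (-(δ / 2))
    convert! this using 1
    simp; field_simp
  rw [intervalIntegral.integral_eq_sub_of_hasDerivAt (fun θ _ => hder θ)]
  · have : 0 ≤ δ / 2 * (1 + δ)⁻¹ := by positivity
    simp
    field_simp at this ⊢
    linarith
  · refine Continuous.intervalIntegrable ?_ _ _
    exact Continuous.div (by fun_prop) (by fun_prop) fun θ => by positivity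

/-- The elementary integral to which the period over `[0, -2/3]` reduces. -/
lemma integral_sin_mul_sqrt {ρ : ℂ} (hρ : ‖ρ - 2 / 3‖ ≤ 1 / 3) :
    ∫ θ in (0 : ℝ)..(Real.pi / 2), (Real.sin θ : ℂ) * (2 / 3 - ρ * (Real.cos θ : ℂ) ^ 2) *
        Complex.sqrt (8 / 3 - ρ * (Real.cos θ : ℂ) ^ 2)
      = (8 / 3 - ρ) * Complex.sqrt (8 / 3 - ρ) / 4 := by
  have hre : ∀ θ : ℝ, 1 ≤ (8 / 3 - ρ * (Real.cos θ : ℂ) ^ 2).re := by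
    intro θ
    have h1 := (abs_le.mp ((abs_re_le_norm _).trans hρ)).2
    have h2 : (8 / 3 - ρ * (Real.cos θ : ℂ) ^ 2).re = 8 / 3 - ρ.re * Real.cos θ ^ 2 := by
      rw [← ofReal_pow, sub_re, re_mul_ofReal]; norm_num
    rw [h2]
    norm_num at h1
    nlinarith [Real.cos_sq_le_one θ, sq_nonneg (Real.cos θ)]
  have hc : Continuous fun θ : ℝ => Complex.sqrt (8 / 3 - ρ * (Real.cos θ : ℂ) ^ 2) :=
    continuousOn_sqrt_re_nonneg.comp_continuous (by fun_prop) fun θ => by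
      show (0 : ℝ) ≤ _; linarith [hre θ]
  -- With `G = 8/3 - ρ cos²`, the derivative is `sin · √G (G/4 - 3ρ cos²/4)`, and the bracket equals
  -- `2/3 - ρ cos²`.
  have hder : ∀ θ : ℝ, HasDerivAt (fun θ : ℝ => -(1 / 4 : ℂ) * ((Real.cos θ : ℂ) *
      ((8 / 3 - ρ * (Real.cos θ : ℂ) ^ 2) * Complex.sqrt (8 / 3 - ρ * (Real.cos θ : ℂ) ^ 2))))
      ((Real.sin θ : ℂ) * (2 / 3 - ρ * (Real.cos θ : ℂ) ^ 2) *
        Complex.sqrt (8 / 3 - ρ * (Real.cos θ : ℂ) ^ 2)) θ := by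
    intro θ
    have h1 : HasDerivAt (fun θ : ℝ => (Real.cos θ : ℂ)) (-(Real.sin θ : ℂ)) θ := by
      have := (Real.hasDerivAt_cos θ).ofReal_comp
      simpa using this
    have h2 : HasDerivAt (fun θ : ℝ => (8 / 3 - ρ * (Real.cos θ : ℂ) ^ 2))
        (2 * ρ * Real.cos θ * Real.sin θ) θ := by
      convert! ((h1.pow 2).const_mul ρ).const_sub (8 / 3) using 1
      simp; ring
    set G := 8 / 3 - ρ * (Real.cos θ : ℂ) ^ 2 with hG
    have hG0 : G ∈ slitPlane := mem_slitPlane_iff.mpr (Or.inl (by linarith [hre θ]))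
    have hGs : Complex.sqrt G ≠ 0 := fun h0 => by
      have := sqrt_re_pos hG0
      rw [h0] at this; simp at this
    have h3 : HasDerivAt Complex.sqrt ((2 * Complex.sqrt G)⁻¹) G := by
      have := (hasDerivAt_id G).cpow_const (c := 2⁻¹) hG0
      convert! this using 1
      rw [id, cpow_sub _ _ (slitPlane_ne_zero hG0), cpow_one]
      have hs := sqrt_sq_eq G
      change _ = 2⁻¹ * (Complex.sqrt G / G) * 1
      have : Complex.sqrt G / G = (Complex.sqrt G)⁻¹ := by
        rw [div_eq_iff (slitPlane_ne_zero hG0)]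
        nth_rewrite 3 [← hs]
        field_simp
      rw [this, mul_inv, mul_one]
    have h4 := h3.comp θ h2
    have h5 := (h1.mul (h2.mul h4)).const_mul (-(1 / 4 : ℂ))
    convert! h5 using 1
    simp only [Function.comp_apply, ← hG, Pi.mul_apply]
    have hs : G * (2 * Complex.sqrt G)⁻¹ = Complex.sqrt G / 2 := by
      conv_lhs => rw [← sqrt_sq_eq G, sqrt_sq_eq G]
      field_simp
      rw [sqrt_sq_eq]
    linear_combination (1 / 2 * ρ * (Real.cos θ : ℂ) ^ 2 * (Real.sin θ : ℂ)) * hs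
  rw [intervalIntegral.integral_eq_sub_of_hasDerivAt (fun θ _ => hder θ)]
  · simp; ring
  · exact Continuous.intervalIntegrable (by fun_prop) _ _

section nearlyDouble

variable {d μ : ℂ}

lemma norm_rho_sub_le (hd : ‖d‖ ≤ 1 / 100) (hμ : ‖μ‖ ≤ ‖d‖ ^ 2) :
    ‖(2 / 3 - μ - d) - 2 / 3‖ ≤ 2 * ‖d‖ := by
  have := norm_nonneg d
  calc ‖(2 / 3 - μ - d) - 2 / 3‖ = ‖-(μ + d)‖ := by ring_nf
    _ = ‖μ + d‖ := norm_neg _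
    _ ≤ ‖μ‖ + ‖d‖ := norm_add_le _ _
    _ ≤ _ := by nlinarith

lemma rho_re_mem (hd : ‖d‖ ≤ 1 / 100) (hμ : ‖μ‖ ≤ ‖d‖ ^ 2) :
    3 / 5 ≤ (2 / 3 - μ - d).re ∧ (2 / 3 - μ - d).re ≤ 1 := by
  have h := abs_le.mp ((abs_re_le_norm _).trans (norm_rho_sub_le hd hμ))
  norm_num at h ⊢
  constructor <;> linarith

lemma rho_norm_mem (hd : ‖d‖ ≤ 1 / 100) (hμ : ‖μ‖ ≤ ‖d‖ ^ 2) :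
    3 / 5 ≤ ‖2 / 3 - μ - d‖ ∧ ‖2 / 3 - μ - d‖ ≤ 1 := by
  refine ⟨(rho_re_mem hd hμ).1.trans (re_le_norm _), ?_⟩
  have h1 := norm_rho_sub_le hd hμ
  have h2 := norm_sub_norm_le (2 / 3 - μ - d) (2 / 3)
  norm_num at h2
  linarith

/-- The lower bound `‖√a + √b‖² ≥ c (sin² θ + ‖d‖)` for `a = ρ sin² θ`, `b = a + 2d`. -/
lemma sum_sqrt_lower (hd : ‖d‖ ≤ 1 / 100) (hμ : ‖μ‖ ≤ ‖d‖ ^ 2) (hre : 0 ≤ d.re) {s : ℝ}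
    (hs : 0 ≤ s) :
    3 / 10 * (s ^ 2 + ‖d‖) ≤ ‖Complex.sqrt (2 / 3 - μ - d) * s +
      Complex.sqrt (2 * d + (2 / 3 - μ - d) * (s : ℂ) ^ 2)‖ ^ 2 := by
  have hρ := rho_re_mem hd hμ
  have hρn := rho_norm_mem hd hμ
  set ρ := 2 / 3 - μ - d
  have hρs := sqrt_re_sq_sub ρ
  have hρ0 := sqrt_re_nonneg ρ
  set b := Complex.sqrt (2 * d + ρ * (s : ℂ) ^ 2) with hb
  have hbre : 0 ≤ (2 * d + ρ * (s : ℂ) ^ 2).re := by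
    rw [← ofReal_pow, add_re, re_mul_ofReal]
    have : (2 * d).re = 2 * d.re := by simp
    rw [this]
    have : 0 ≤ ρ.re * s ^ 2 := mul_nonneg (by linarith) (sq_nonneg s)
    linarith
  have hbs := sqrt_re_sq_sub (2 * d + ρ * (s : ℂ) ^ 2)
  have key := norm_sq_add_norm_sq_le (a := Complex.sqrt ρ * s) (b := b)
    (by rw [re_mul_ofReal]; positivity) (sqrt_re_nonneg _)
    (by rw [re_mul_ofReal, im_mul_ofReal, mul_pow, mul_pow]
        exact mul_le_mul_of_nonneg_right (by linarith) (sq_nonneg s))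
    (by rw [← hb] at hbs; linarith)
  refine le_trans ?_ key
  have e1 : ‖Complex.sqrt ρ * (s : ℂ)‖ ^ 2 = ‖ρ‖ * s ^ 2 := by
    rw [norm_mul, mul_pow, norm_sqrt_sq, norm_real, Real.norm_eq_abs, sq_abs]
  rw [e1, hb, norm_sqrt_sq]
  -- Hence the sum of the two squared norms is at least the maximum of `‖ρ‖ s²` and `2‖d‖`.
  have e2 : 2 * ‖d‖ - ‖ρ‖ * s ^ 2 ≤ ‖2 * d + ρ * (s : ℂ) ^ 2‖ := by
    have := norm_sub_norm_le (2 * d) (-(ρ * (s : ℂ) ^ 2))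
    rw [sub_neg_eq_add, norm_neg, norm_mul, norm_mul, norm_pow, norm_real, Real.norm_eq_abs,
      sq_abs] at this
    simpa using this
  have e3 : 0 ≤ ‖2 * d + ρ * (s : ℂ) ^ 2‖ := norm_nonneg _
  nlinarith [sq_nonneg s]

/-- With `a = ρs²` and `b = a + 2d`: `√a √b = (a + b)/2 - (√b - √a)²/2` and `(√b - √a)(√b + √a) =
2d`. This separates a polynomial part from the term of order `d²` that carries the logarithm. -/
lemma sum_sqrt_identity (hd : ‖d‖ ≤ 1 / 100) (hμ : ‖μ‖ ≤ ‖d‖ ^ 2) (hre : 0 ≤ d.re) {s : ℝ}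
    (hs : 0 ≤ s) :
    Complex.sqrt (2 / 3 - μ - d) * s * Complex.sqrt (2 * d + (2 / 3 - μ - d) * (s : ℂ) ^ 2)
      = d + (2 / 3 - μ - d) * (s : ℂ) ^ 2 - 2 * d ^ 2 / (Complex.sqrt (2 / 3 - μ - d) * s +
        Complex.sqrt (2 * d + (2 / 3 - μ - d) * (s : ℂ) ^ 2)) ^ 2 := by
  have hlow := sum_sqrt_lower hd hμ hre hs
  have hρ2 := sqrt_sq_eq (2 / 3 - μ - d)
  have hb2 := sqrt_sq_eq (2 * d + (2 / 3 - μ - d) * (s : ℂ) ^ 2)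
  set ρ := 2 / 3 - μ - d
  set b := Complex.sqrt (2 * d + ρ * (s : ℂ) ^ 2)
  set c := Complex.sqrt ρ
  rcases eq_or_ne (c * s + b) 0 with h0 | h0
  -- The denominator vanishes only for `d = 0`, `s = 0`, where division by zero gives the right
  -- value `0`.
  · rw [h0] at hlow
    simp only [norm_zero, ne_eq, OfNat.ofNat_ne_zero, not_false_eq_true, zero_pow] at hlow
    have hd0 : ‖d‖ = 0 := by nlinarith [sq_nonneg s, norm_nonneg d]
    have hs0 : s = 0 := by
      have : s ^ 2 = 0 := le_antisymm (by nlinarith [norm_nonneg d]) (sq_nonneg s)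
      exact pow_eq_zero_iff two_ne_zero |>.mp this
    rw [norm_eq_zero.mp hd0, hs0]; simp
  · have hne : (c * s + b) ^ 2 ≠ 0 := pow_ne_zero 2 h0
    rw [eq_sub_iff_add_eq, ← eq_sub_iff_add_eq', div_eq_iff hne]
    linear_combination (((c * s + b) ^ 2 - (b ^ 2 - (c * s) ^ 2 + 2 * d)) / 2) * hb2
      + (((c * s + b) ^ 2 + (b ^ 2 - (c * s) ^ 2 + 2 * d)) / 2) * (s : ℂ) ^ 2 * hρ2

lemma cofactor_re_bound (hd : ‖d‖ ≤ 1 / 100) (hμ : ‖μ‖ ≤ ‖d‖ ^ 2) (x : ℝ) (hx : x ^ 2 ≤ 1) :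
    1 ≤ (8 / 3 + 2 * μ - (2 / 3 - μ - d) * (x : ℂ) ^ 2).re := by
  have hρ := rho_re_mem hd hμ
  set ρ := 2 / 3 - μ - d
  have h2 : (8 / 3 + 2 * μ - ρ * (x : ℂ) ^ 2).re = 8 / 3 + 2 * μ.re - ρ.re * x ^ 2 := by
    rw [← ofReal_pow, sub_re, re_mul_ofReal]; norm_num
  have h3 := (abs_le.mp (abs_re_le_norm μ)).1
  rw [h2]
  nlinarith [sq_nonneg x, norm_nonneg d, sq_nonneg ‖d‖]

lemma norm_sqrt_cofactor_sub_le (hd : ‖d‖ ≤ 1 / 100) (hμ : ‖μ‖ ≤ ‖d‖ ^ 2) (θ : ℝ) :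
    ‖Complex.sqrt (8 / 3 + 2 * μ - (2 / 3 - μ - d) * (Real.cos θ : ℂ) ^ 2) - (√2 : ℝ)‖
      ≤ 5 * (Real.sin θ ^ 2 + ‖d‖) := by
  have hρ := rho_norm_mem hd hμ
  have hρ' := norm_rho_sub_le hd hμ
  set ρ := 2 / 3 - μ - d
  have h := norm_sqrt_sub_sqrt_le (8 / 3 + 2 * μ - ρ * (Real.cos θ : ℂ) ^ 2) (b := (2 : ℝ))
    (by norm_num)
  rw [sqrt_ofReal' (by norm_num)] at h
  refine h.trans ?_
  have hsc : (Real.cos θ : ℂ) ^ 2 = 1 - (Real.sin θ : ℂ) ^ 2 := by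
    rw [← ofReal_pow, Real.cos_sq']; push_cast; ring
  have e1 : 8 / 3 + 2 * μ - ρ * (Real.cos θ : ℂ) ^ 2 - ((2 : ℝ) : ℂ)
      = 2 * μ - (ρ - 2 / 3) + ρ * ((Real.sin θ ^ 2 : ℝ) : ℂ) := by
    rw [hsc]; push_cast; ring
  have e2 := norm_add_le (2 * μ - (ρ - 2 / 3)) (ρ * ((Real.sin θ ^ 2 : ℝ) : ℂ))
  have e3 := norm_sub_le (2 * μ) (ρ - 2 / 3)
  rw [norm_mul ρ, norm_real, Real.norm_eq_abs, abs_of_nonneg (sq_nonneg _)] at e2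
  rw [norm_mul] at e3
  simp only [Complex.norm_ofNat] at e3
  rw [e1]
  nlinarith [sq_nonneg (Real.sin θ), norm_nonneg d]

lemma norm_sqrt_rho_sub_le (hd : ‖d‖ ≤ 1 / 100) (hμ : ‖μ‖ ≤ ‖d‖ ^ 2) :
    ‖Complex.sqrt (2 / 3 - μ - d) - (√(2 / 3) : ℝ)‖ ≤ 4 * ‖d‖ := by
  have h := norm_sqrt_sub_sqrt_le (2 / 3 - μ - d) (b := (2 / 3 : ℝ)) (by norm_num)
  rw [sqrt_ofReal' (by norm_num)] at h
  refine h.trans ?_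
  push_cast
  linarith [norm_rho_sub_le hd hμ]

/-- The leading, non-logarithmic part of the period. -/
lemma norm_period_main_sub_le (hd : ‖d‖ ≤ 1 / 100) (hμ : ‖μ‖ ≤ ‖d‖ ^ 2) :
    ‖Complex.sqrt (2 / 3 - μ - d) * ((8 / 3 - (2 / 3 - μ - d)) *
      Complex.sqrt (8 / 3 - (2 / 3 - μ - d)) / 4) - (1 / √3 : ℝ)‖ ≤ 40 * ‖d‖ ^ 2 := by
  have hu := norm_sqrt_rho_sub_le hd hμ
  have hx := norm_rho_sub_le hd hμ
  have hu2 := sqrt_sq_eq (2 / 3 - μ - d)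
  have hw2 := sqrt_sq_eq (8 / 3 - (2 / 3 - μ - d))
  have hw := norm_sqrt_sub_sqrt_le (8 / 3 - (2 / 3 - μ - d)) (b := (2 : ℝ)) (by norm_num)
  rw [sqrt_ofReal' (by norm_num)] at hw
  set u := Complex.sqrt (2 / 3 - μ - d)
  set w := Complex.sqrt (8 / 3 - (2 / 3 - μ - d))
  set x : ℂ := (2 / 3 - μ - d) - 2 / 3 with hxdef
  have hρ : 8 / 3 - (2 / 3 - μ - d) = 2 - x := by rw [hxdef]; ring
  have hρ' : 2 / 3 - μ - d = 2 / 3 + x := by rw [hxdef]; ring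
  rw [hρ] at hw hw2 ⊢
  rw [hρ'] at hu2
  have hd0 := norm_nonneg d
  have hw' : ‖w - (√2 : ℝ)‖ ≤ 4 * ‖d‖ := by
    refine hw.trans ?_
    rw [show 2 - x - ((2 : ℝ) : ℂ) = -x by push_cast; ring, norm_neg]
    linarith
  have s2 : √2 ≤ 3 / 2 := Real.sqrt_le_iff.mpr (by norm_num)
  have s3 : √(2 / 3) ≤ 1 := Real.sqrt_le_iff.mpr (by norm_num)
  have s2' : 0 ≤ √2 := Real.sqrt_nonneg _
  have s3' : 0 ≤ √(2 / 3) := Real.sqrt_nonneg _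
  have hprod : √(2 / 3) * 2 * √2 = 4 / √3 := by
    rw [Real.sqrt_div (by norm_num)]
    have : √2 * √2 = 2 := Real.mul_self_sqrt (by norm_num)
    field_simp
    linarith
  have h43 : 2 ≤ 4 / √3 := by
    rw [le_div_iff₀ (by positivity)]
    nlinarith [Real.sq_sqrt (show (0 : ℝ) ≤ 3 by norm_num), Real.sqrt_nonneg 3]
  set N := u * ((2 - x) * w) with hN
  have hNsub : ‖N - (4 / √3 : ℝ)‖ ≤ 1 := by
    have e : N - (4 / √3 : ℝ) = (u - (√(2 / 3) : ℝ)) * ((2 - x) * w)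
        + (√(2 / 3) : ℝ) * (2 * (w - (√2 : ℝ)) - x * w) := by
      rw [← hprod, hN]; push_cast; ring
    have n1 : ‖w‖ ≤ 2 := by
      have := norm_sub_norm_le w (√2 : ℝ)
      rw [norm_real, Real.norm_eq_abs, abs_of_nonneg s2'] at this
      linarith
    have n2 : ‖(2 - x) * w‖ ≤ 6 := by
      rw [norm_mul]
      have := norm_sub_le 2 x
      simp only [Complex.norm_ofNat] at this
      nlinarith [norm_nonneg w, norm_nonneg x]
    have n3 : ‖2 * (w - (√2 : ℝ)) - x * w‖ ≤ 12 * ‖d‖ := by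
      refine (norm_sub_le _ _).trans ?_
      rw [norm_mul, norm_mul]
      simp only [Complex.norm_ofNat]
      nlinarith [norm_nonneg w, norm_nonneg x]
    rw [e]
    refine (norm_add_le _ _).trans ?_
    rw [norm_mul (u - _), norm_mul ((√(2 / 3) : ℝ) : ℂ), norm_real, Real.norm_eq_abs,
      abs_of_nonneg s3']
    nlinarith [norm_nonneg ((2 - x) * w), norm_nonneg (2 * (w - (√2 : ℝ)) - x * w),
      norm_nonneg (u - (√(2 / 3) : ℝ))]
  have hNre : 0 ≤ N.re := by
    have := (abs_le.mp ((abs_re_le_norm _).trans hNsub)).1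
    rw [sub_re, ofReal_re] at this
    linarith
  -- `N² = (2/3 + x)(2 - x)³` is stationary at `x = 0`: this is why the main term has an error of
  -- order `‖d‖²` and no linear term.
  have hNsq : N ^ 2 - ((4 / √3 : ℝ) : ℂ) ^ 2 = x ^ 2 * (-8 + 16 / 3 * x - x ^ 2) := by
    have e1 : N ^ 2 = (2 / 3 + x) * (2 - x) ^ 2 * (2 - x) := by
      rw [← hu2, hN]
      nth_rewrite 3 [← hw2]
      ring
    have e2 : ((4 / √3 : ℝ) : ℂ) ^ 2 = 16 / 3 := by
      rw [← ofReal_pow, div_pow, Real.sq_sqrt (by norm_num)]; norm_num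
    rw [e1, e2]; ring
  have hbig : 2 ≤ ‖N + (4 / √3 : ℝ)‖ := by
    refine le_trans ?_ (re_le_norm _)
    rw [add_re, ofReal_re]
    linarith
  have hle : ‖N - (4 / √3 : ℝ)‖ * 2 ≤ ‖x‖ ^ 2 * 10 := by
    calc ‖N - (4 / √3 : ℝ)‖ * 2 ≤ ‖N - (4 / √3 : ℝ)‖ * ‖N + (4 / √3 : ℝ)‖ := by gcongr
      _ = ‖x ^ 2 * (-8 + 16 / 3 * x - x ^ 2)‖ := by rw [← norm_mul, ← hNsq]; ring_nf
      _ ≤ _ := by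
        rw [norm_mul, norm_pow]
        refine mul_le_mul_of_nonneg_left ?_ (sq_nonneg _)
        have e1 := norm_sub_le (-8 + 16 / 3 * x) (x ^ 2)
        have e2 := norm_add_le (-8) (16 / 3 * x)
        rw [norm_pow] at e1
        rw [norm_mul] at e2
        norm_num at e2
        nlinarith [norm_nonneg x]
  have hfin : u * ((2 - x) * w / 4) - (1 / √3 : ℝ) = (1 / 4 : ℂ) * (N - (4 / √3 : ℝ)) := by
    rw [hN]; push_cast; ring
  rw [hfin, norm_mul]
  have : ‖(1 / 4 : ℂ)‖ = 1 / 4 := by norm_num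
  rw [this]
  nlinarith [norm_nonneg x]

end nearlyDouble

section nearlyDouble

variable {d μ : ℂ}

/-- The denominator `(√a + √b)²` for `a = ρ sin² θ`, `b = a + 2d`. -/
noncomputable def sumSqrtSq (d μ : ℂ) (θ : ℝ) : ℂ :=
  (Complex.sqrt (2 / 3 - μ - d) * Real.sin θ +
    Complex.sqrt (2 * d + (2 / 3 - μ - d) * (Real.sin θ : ℂ) ^ 2)) ^ 2

/-- The square root `√(r₁ cos² θ - r₅)`. -/
noncomputable def cofactorSqrt (d μ : ℂ) (θ : ℝ) : ℂ :=
  Complex.sqrt (8 / 3 + 2 * μ - (2 / 3 - μ - d) * (Real.cos θ : ℂ) ^ 2)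

/-- The part of the integrand which produces the logarithm. -/
noncomputable def logIntegrand (d μ : ℂ) (θ : ℝ) : ℂ :=
  2 * Complex.sqrt (2 / 3 - μ - d) * Real.sin θ * cofactorSqrt d μ θ / sumSqrtSq d μ θ

lemma continuous_cofactorSqrt (hd : ‖d‖ ≤ 1 / 100) (hμ : ‖μ‖ ≤ ‖d‖ ^ 2) :
    Continuous (cofactorSqrt d μ) :=
  continuousOn_sqrt_re_nonneg.comp_continuous (by fun_prop) fun θ => by
    have := cofactor_re_bound hd hμ (Real.cos θ) (Real.cos_sq_le_one θ)
    show (0 : ℝ) ≤ _; linarith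

lemma continuous_sqrt_sin (hd : ‖d‖ ≤ 1 / 100) (hμ : ‖μ‖ ≤ ‖d‖ ^ 2) (hre : 0 ≤ d.re) :
    Continuous fun θ : ℝ =>
      Complex.sqrt (2 * d + (2 / 3 - μ - d) * (Real.sin θ : ℂ) ^ 2) :=
  continuousOn_sqrt_re_nonneg.comp_continuous (by fun_prop) fun θ => by
    have h := (rho_re_mem hd hμ).1
    have : (2 * d + (2 / 3 - μ - d) * (Real.sin θ : ℂ) ^ 2).re
        = 2 * d.re + (2 / 3 - μ - d).re * Real.sin θ ^ 2 := by
      rw [← ofReal_pow, add_re, re_mul_ofReal]; simp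
    show (0 : ℝ) ≤ _
    rw [this]
    have : 0 ≤ (2 / 3 - μ - d).re * Real.sin θ ^ 2 := mul_nonneg (by linarith) (sq_nonneg _)
    linarith

lemma norm_sumSqrtSq_lower (hd : ‖d‖ ≤ 1 / 100) (hμ : ‖μ‖ ≤ ‖d‖ ^ 2) (hre : 0 ≤ d.re) {θ : ℝ}
    (hs : 0 ≤ Real.sin θ) :
    3 / 10 * (Real.sin θ ^ 2 + ‖d‖) ≤ ‖sumSqrtSq d μ θ‖ := by
  rw [sumSqrtSq, norm_pow]
  exact sum_sqrt_lower hd hμ hre hs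

/-- By `sum_sqrt_identity`, `S = 4ρ sin² + 4d - 4d²/S` with `ρ ≈ 2/3`. All corrections are of order
`‖d‖`, uniformly in `θ`. -/
lemma norm_sumSqrtSq_sub_le (hd : ‖d‖ ≤ 1 / 100) (hμ : ‖μ‖ ≤ ‖d‖ ^ 2) (hre : 0 ≤ d.re)
    (hd0 : d ≠ 0) {θ : ℝ} (hs : 0 ≤ Real.sin θ) :
    ‖sumSqrtSq d μ θ - (8 / 3 * (Real.sin θ ^ 2 + ‖d‖) : ℝ)‖ ≤ 29 * ‖d‖ := by
  have hδ : 0 < ‖d‖ := norm_pos_iff.mpr hd0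
  have hlow := norm_sumSqrtSq_lower hd hμ hre hs
  have hid := sum_sqrt_identity hd hμ hre hs
  have hρ2 := sqrt_sq_eq (2 / 3 - μ - d)
  have hb2 := sqrt_sq_eq (2 * d + (2 / 3 - μ - d) * (Real.sin θ : ℂ) ^ 2)
  have hx := norm_rho_sub_le hd hμ
  rw [← sumSqrtSq] at hid
  set S := sumSqrtSq d μ θ with hS
  set ρ := 2 / 3 - μ - d
  have e1 : S - (8 / 3 * (Real.sin θ ^ 2 + ‖d‖) : ℝ)
      = 4 * d + 4 * ((ρ - 2 / 3) * (Real.sin θ ^ 2 : ℝ)) - (8 / 3 * ‖d‖ : ℝ)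
        - 4 * d ^ 2 / S := by
    have : S = 4 * d + 4 * ρ * (Real.sin θ : ℂ) ^ 2 - 4 * d ^ 2 / S := by
      conv_lhs => rw [hS, sumSqrtSq]
      linear_combination (Real.sin θ : ℂ) ^ 2 * hρ2 + hb2 + 2 * hid
    rw [sub_eq_iff_eq_add]
    conv_lhs => rw [this]
    push_cast; ring
  have hs1 : Real.sin θ ^ 2 ≤ 1 := Real.sin_sq_le_one θ
  have n1 : ‖4 * d ^ 2 / S‖ ≤ 40 / 3 * ‖d‖ := by
    rw [norm_div, div_le_iff₀ (by nlinarith [sq_nonneg (Real.sin θ)]), norm_mul, norm_pow]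
    simp only [Complex.norm_ofNat]
    nlinarith [sq_nonneg (Real.sin θ)]
  have n2 : ‖4 * ((ρ - 2 / 3) * ((Real.sin θ ^ 2 : ℝ) : ℂ))‖ ≤ 8 * ‖d‖ := by
    rw [norm_mul, norm_mul, norm_real, Real.norm_eq_abs, abs_of_nonneg (sq_nonneg _)]
    simp only [Complex.norm_ofNat]
    nlinarith [norm_nonneg (ρ - 2 / 3), sq_nonneg (Real.sin θ)]
  have n3 : ‖((8 / 3 * ‖d‖ : ℝ) : ℂ)‖ = 8 / 3 * ‖d‖ := by
    rw [norm_real, Real.norm_eq_abs, abs_of_nonneg (by positivity)]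
  have n4 : ‖4 * d‖ = 4 * ‖d‖ := by rw [norm_mul]; simp
  rw [e1]
  refine (norm_sub_le _ _).trans ?_
  have m1 := norm_sub_le (4 * d + 4 * ((ρ - 2 / 3) * ((Real.sin θ ^ 2 : ℝ) : ℂ)))
    ((8 / 3 * ‖d‖ : ℝ) : ℂ)
  have m2 := norm_add_le (4 * d) (4 * ((ρ - 2 / 3) * ((Real.sin θ ^ 2 : ℝ) : ℂ)))
  linarith

lemma norm_ofReal_div_sub_le {S : ℂ} {k E : ℝ} (hk : 0 < k) (hE : 0 < E) (hS : S ≠ 0) :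
    ‖(k : ℂ) / S - ((k / E : ℝ) : ℂ)‖ = k * ‖S - (E : ℂ)‖ / (‖S‖ * E) := by
  have hE' : (E : ℂ) ≠ 0 := by exact_mod_cast hE.ne'
  have : (k : ℂ) / S - ((k / E : ℝ) : ℂ) = -(k * (S - E)) / (S * E) := by
    rw [ofReal_div]
    field_simp
    ring
  rw [this, norm_div, norm_neg, norm_mul, norm_mul, norm_real, norm_real, Real.norm_eq_abs,
    Real.norm_eq_abs, abs_of_pos hk, abs_of_pos hE]

lemma sub_mul_mem_of_sq_add_sq {s c : ℝ} (hs : 0 ≤ s) (hc : 0 ≤ c) (h : s ^ 2 + c ^ 2 = 1) :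
    0 ≤ s - s * c ∧ s - s * c ≤ s ^ 2 := by
  have hc1 : c ≤ 1 := by nlinarith
  have hs1 : s ≤ 1 := by nlinarith
  have e : 1 - c ≤ s ^ 2 := by nlinarith
  have : s * (1 - c) ≤ 1 * (1 - c) := mul_le_mul_of_nonneg_right hs1 (by linarith)
  exact ⟨by nlinarith [mul_nonneg hs (sub_nonneg.mpr hc1)], by linarith⟩

/-- The numerator is `(4/√3) sin` with relative error `O(Q)`, where `Q = sin² + ‖d‖`, and the
denominator is `(8/3) Q + O(‖d‖)`. A factor `cos` is inserted to make the comparison kernels exactly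
integrable; it costs a bounded amount since `s - s c ≤ s² ≤ Q`. -/
lemma norm_logIntegrand_sub_le (hd : ‖d‖ ≤ 1 / 100) (hμ : ‖μ‖ ≤ ‖d‖ ^ 2) (hre : 0 ≤ d.re)
    (hd0 : d ≠ 0) {θ : ℝ} (hs : 0 ≤ Real.sin θ) (hc : 0 ≤ Real.cos θ) :
    ‖logIntegrand d μ θ -
      (√3 / 2 * (Real.sin θ * Real.cos θ / (Real.sin θ ^ 2 + ‖d‖)) : ℝ)‖
      ≤ 320 + 90 * (Real.sin θ * Real.cos θ * ‖d‖ / (Real.sin θ ^ 2 + ‖d‖) ^ 2) := by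
  have hδ : 0 < ‖d‖ := norm_pos_iff.mpr hd0
  have hlow := norm_sumSqrtSq_lower hd hμ hre hs
  have hE := norm_sumSqrtSq_sub_le hd hμ hre hd0 hs
  have hu := norm_sqrt_rho_sub_le hd hμ
  have hg := norm_sqrt_cofactor_sub_le hd hμ θ
  rw [← cofactorSqrt] at hg
  unfold logIntegrand
  set S := sumSqrtSq d μ θ
  set g := cofactorSqrt d μ θ
  set u := Complex.sqrt (2 / 3 - μ - d)
  set δ := ‖d‖
  set s := Real.sin θ
  set c := Real.cos θ
  have hsc : s ^ 2 + c ^ 2 = 1 := Real.sin_sq_add_cos_sq θ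
  have hc1 : c ≤ 1 := Real.cos_le_one θ
  have hs1 : s ≤ 1 := Real.sin_le_one θ
  set Q := s ^ 2 + δ with hQ
  have hQ0 : 0 < Q := by positivity
  have hsQ : s ^ 2 ≤ Q := by linarith
  have hS0 : 0 < ‖S‖ := lt_of_lt_of_le (by positivity) hlow
  have hSne : S ≠ 0 := norm_pos_iff.mp hS0
  have s2 : √2 ≤ 3 / 2 := Real.sqrt_le_iff.mpr (by norm_num)
  have s3 : √(2 / 3) ≤ 1 := Real.sqrt_le_iff.mpr (by norm_num)
  have s2' : 0 ≤ √2 := Real.sqrt_nonneg _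
  have s3' : 0 ≤ √(2 / 3) := Real.sqrt_nonneg _
  have t3 : √3 ^ 2 = 3 := Real.sq_sqrt (by norm_num)
  have t3' : 0 < √3 := by positivity
  have t3'' : √3 ≤ 2 := Real.sqrt_le_iff.mpr (by norm_num)
  have hprod : √(2 / 3) * 2 * √2 = 4 / √3 := by
    rw [Real.sqrt_div (by norm_num)]
    have : √2 * √2 = 2 := Real.mul_self_sqrt (by norm_num)
    field_simp
    linarith
  set k := 4 / √3 with hk
  have hk0 : 0 < k := by positivity
  have hk1 : k ≤ 12 / 5 := by
    rw [hk, div_le_iff₀ t3']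
    nlinarith
  have hkE : k / (8 / 3 * Q) = √3 / 2 / Q := by
    rw [hk]; field_simp; linarith
  have hnum : ‖2 * u * g - (k : ℂ)‖ ≤ 66 * Q := by
    have e : 2 * u * g - (k : ℂ) = 2 * ((u - (√(2 / 3) : ℝ)) * g)
        + 2 * ((√(2 / 3) : ℝ) * (g - (√2 : ℝ))) := by
      rw [← hprod]; push_cast; ring
    have n1 : ‖g‖ ≤ 7 := by
      have := norm_sub_norm_le g (√2 : ℝ)
      rw [norm_real, Real.norm_eq_abs, abs_of_nonneg s2'] at this
      nlinarith
    rw [e]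
    refine (norm_add_le _ _).trans ?_
    rw [norm_mul, norm_mul, norm_mul, norm_mul, norm_real, Real.norm_eq_abs, abs_of_nonneg s3']
    simp only [Complex.norm_ofNat]
    have n2 : ‖u - (√(2 / 3) : ℝ)‖ * ‖g‖ ≤ 4 * δ * 7 := by gcongr
    have n3 : √(2 / 3) * ‖g - (√2 : ℝ)‖ ≤ 1 * (5 * Q) := by gcongr
    nlinarith [sq_nonneg s]
  have hA : ‖(2 * u * g - (k : ℂ)) / S‖ ≤ 220 := by
    rw [norm_div, div_le_iff₀ hS0]
    linarith
  have hB : ‖(k : ℂ) / S - ((√3 / 2 / Q : ℝ) : ℂ)‖ ≤ 90 * (δ / Q ^ 2) := by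
    have hE8 : 0 < 8 / 3 * Q := by positivity
    rw [← hkE, norm_ofReal_div_sub_le hk0 hE8 hSne, div_le_iff₀ (mul_pos hS0 hE8)]
    have h1 : k * ‖S - (8 / 3 * Q : ℝ)‖ ≤ 12 / 5 * (29 * δ) :=
      mul_le_mul hk1 hE (norm_nonneg _) (by norm_num)
    have h2 : 90 * (δ / Q ^ 2) * (3 / 10 * Q * (8 / 3 * Q))
        ≤ 90 * (δ / Q ^ 2) * (‖S‖ * (8 / 3 * Q)) :=
      mul_le_mul_of_nonneg_left (mul_le_mul_of_nonneg_right hlow hE8.le) (by positivity)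
    have h3 : 90 * (δ / Q ^ 2) * (3 / 10 * Q * (8 / 3 * Q)) = 72 * δ := by field_simp; norm_num
    linarith
  obtain ⟨g1, g2⟩ := sub_mul_mem_of_sq_add_sq hs hc hsc
  have hC : |√3 / 2 / Q * (s - s * c)| ≤ 1 := by
    rw [abs_of_nonneg (mul_nonneg (by positivity) g1), div_mul_eq_mul_div, div_le_one hQ0]
    have : √3 / 2 * (s - s * c) ≤ 1 * (s - s * c) :=
      mul_le_mul_of_nonneg_right (by linarith) g1
    linarith
  have hD : s * (δ / Q ^ 2) ≤ s * c * δ / Q ^ 2 + 1 := by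
    have h3 : δ ≤ Q := by linarith [sq_nonneg s]
    have h4 : (s - s * c) * δ ≤ Q * Q := mul_le_mul (by linarith) h3 hδ.le hQ0.le
    rw [← sub_le_iff_le_add', mul_div_assoc', ← sub_div, div_le_one (by positivity)]
    linarith
  have hsplit : 2 * u * s * g / S - ((√3 / 2 * (s * c / Q) : ℝ) : ℂ)
      = s * ((2 * u * g - (k : ℂ)) / S) + s * ((k : ℂ) / S - ((√3 / 2 / Q : ℝ) : ℂ))
        + ((√3 / 2 / Q * (s - s * c) : ℝ) : ℂ) := by
    have : (Q : ℂ) ≠ 0 := by exact_mod_cast hQ0.ne'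
    push_cast
    field_simp
    ring
  rw [hsplit]
  refine (norm_add₃_le).trans ?_
  rw [norm_mul, norm_mul, norm_real, norm_real, Real.norm_eq_abs, Real.norm_eq_abs,
    abs_of_nonneg hs]
  have f1 : s * ‖(2 * u * g - (k : ℂ)) / S‖ ≤ 1 * 220 := by gcongr
  have f2 : s * ‖(k : ℂ) / S - ((√3 / 2 / Q : ℝ) : ℂ)‖ ≤ s * (90 * (δ / Q ^ 2)) := by gcongr
  linarith

lemma intervalIntegrable_logIntegrand (hd : ‖d‖ ≤ 1 / 100) (hμ : ‖μ‖ ≤ ‖d‖ ^ 2)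
    (hre : 0 ≤ d.re) (hd0 : d ≠ 0) :
    IntervalIntegrable (logIntegrand d μ) volume 0 (Real.pi / 2) := by
  have hδ : 0 < ‖d‖ := norm_pos_iff.mpr hd0
  refine ContinuousOn.intervalIntegrable ?_
  rw [Set.uIcc_of_le (by positivity)]
  unfold logIntegrand
  have c1 := continuous_cofactorSqrt hd hμ
  have c2 := continuous_sqrt_sin hd hμ hre
  refine ContinuousOn.div (by fun_prop) (Continuous.continuousOn ?_) fun θ hθ => ?_
  · unfold sumSqrtSq
    fun_prop
  · have := norm_sumSqrtSq_lower hd hμ hre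
      (Real.sin_nonneg_of_nonneg_of_le_pi hθ.1 (by linarith [hθ.2, Real.pi_pos]))
    exact norm_pos_iff.mp (lt_of_lt_of_le (by positivity) this)

lemma norm_integral_logIntegrand_sub_le (hd : ‖d‖ ≤ 1 / 100) (hμ : ‖μ‖ ≤ ‖d‖ ^ 2)
    (hre : 0 ≤ d.re) (hd0 : d ≠ 0) :
    ‖(∫ θ in (0 : ℝ)..(Real.pi / 2), logIntegrand d μ θ) + (√3 / 4 * Real.log ‖d‖ : ℝ)‖
      ≤ 600 := by
  have hδ : 0 < ‖d‖ := norm_pos_iff.mpr hd0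
  have hpi := Real.pi_pos
  have hpi4 := Real.pi_le_four
  have hmem : ∀ θ ∈ Set.Icc 0 (Real.pi / 2), 0 ≤ Real.sin θ ∧ 0 ≤ Real.cos θ := fun θ hθ =>
    ⟨Real.sin_nonneg_of_nonneg_of_le_pi hθ.1 (by linarith [hθ.2]),
      Real.cos_nonneg_of_mem_Icc ⟨by linarith [hθ.1], hθ.2⟩⟩
  set f : ℝ → ℝ := fun θ => √3 / 2 * (Real.sin θ * Real.cos θ / (Real.sin θ ^ 2 + ‖d‖)) with hf
  have hfc : Continuous f := by
    refine continuous_const.mul (Continuous.div (by fun_prop) (by fun_prop) fun θ => ?_)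
    positivity
  set b : ℝ → ℝ := fun θ =>
    Real.sin θ * Real.cos θ * ‖d‖ / (Real.sin θ ^ 2 + ‖d‖) ^ 2 with hb
  have hbc : Continuous b := Continuous.div (by fun_prop) (by fun_prop) fun θ => by positivity
  have hint := intervalIntegrable_logIntegrand hd hμ hre hd0
  have hfi : ∫ θ in (0 : ℝ)..(Real.pi / 2), (f θ : ℂ)
      = (√3 / 4 * (Real.log (1 + ‖d‖) - Real.log ‖d‖) : ℝ) := by
    rw [intervalIntegral.integral_ofReal, hf, intervalIntegral.integral_const_mul,
      integral_sin_mul_cos_div hδ]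
    congr 1; ring
  have hmain : ‖(∫ θ in (0 : ℝ)..(Real.pi / 2), logIntegrand d μ θ)
      - (√3 / 4 * (Real.log (1 + ‖d‖) - Real.log ‖d‖) : ℝ)‖ ≤ 320 * 2 * (Real.pi / 4) + 90 / 2 := by
    rw [← hfi, ← intervalIntegral.integral_sub hint
      (Continuous.intervalIntegrable (by fun_prop) _ _)]
    refine (intervalIntegral.norm_integral_le_of_norm_le (g := fun θ => 320 + 90 * b θ)
      (by positivity) (Eventually.of_forall fun θ hθ => ?_)
      (Continuous.intervalIntegrable (by fun_prop) _ _)).trans ?_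
    · have := hmem θ ⟨hθ.1.le, hθ.2⟩
      exact norm_logIntegrand_sub_le hd hμ hre hd0 this.1 this.2
    · rw [intervalIntegral.integral_add (by simp) (Continuous.intervalIntegrable (by fun_prop) _ _),
        intervalIntegral.integral_const_mul]
      have := integral_sin_mul_cos_div_sq_le hδ
      simp only [intervalIntegral.integral_const, smul_eq_mul]
      linarith
  have hlog : |√3 / 4 * Real.log (1 + ‖d‖)| ≤ 1 := by
    have h1 : 0 ≤ Real.log (1 + ‖d‖) := Real.log_nonneg (by linarith)
    have h2 : Real.log (1 + ‖d‖) ≤ 1 := by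
      have := Real.log_le_sub_one_of_pos (show 0 < 1 + ‖d‖ by linarith)
      linarith
    have h3 : √3 ≤ 2 := Real.sqrt_le_iff.mpr (by norm_num)
    rw [abs_of_nonneg (by positivity)]
    nlinarith [Real.sqrt_nonneg 3]
  have hpi' := Real.pi_lt_d2
  have hfin : (∫ θ in (0 : ℝ)..(Real.pi / 2), logIntegrand d μ θ) + (√3 / 4 * Real.log ‖d‖ : ℝ)
      = ((∫ θ in (0 : ℝ)..(Real.pi / 2), logIntegrand d μ θ)
      - (√3 / 4 * (Real.log (1 + ‖d‖) - Real.log ‖d‖) : ℝ))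
      + (√3 / 4 * Real.log (1 + ‖d‖) : ℝ) := by push_cast; ring
  rw [hfin]
  refine (norm_add_le _ _).trans ?_
  rw [norm_real, Real.norm_eq_abs]
  linarith

/-- The expansion of the period over the segment from `0` to one of two nearly equal zeros. -/
theorem norm_period_sub_le (hd : ‖d‖ ≤ 1 / 100) (hμ : ‖μ‖ ≤ ‖d‖ ^ 2) (hre : 0 ≤ d.re) :
    ‖(2 / 3 - μ - d) * (∫ θ in (0 : ℝ)..(Real.pi / 2), (Real.sin θ : ℂ) ^ 2 *
      (Complex.sqrt (2 * d + (2 / 3 - μ - d) * (Real.sin θ : ℂ) ^ 2) * cofactorSqrt d μ θ))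
      - ((1 / √3 : ℝ) + d ^ 2 * (√3 / 4 * Real.log ‖d‖ : ℝ))‖ ≤ 700 * ‖d‖ ^ 2 := by
  have hpi := Real.pi_pos
  have hpi' := Real.pi_lt_d2
  have hmem : ∀ θ ∈ Set.Icc 0 (Real.pi / 2), 0 ≤ Real.sin θ := fun θ hθ =>
    Real.sin_nonneg_of_nonneg_of_le_pi hθ.1 (by linarith [hθ.2])
  have cg := continuous_cofactorSqrt hd hμ
  have cb := continuous_sqrt_sin hd hμ hre
  have hu2 := sqrt_sq_eq (2 / 3 - μ - d)
  have hun := norm_sqrt_rho_sub_le hd hμ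
  have hρ := norm_rho_sub_le hd hμ
  have hρn := rho_norm_mem hd hμ
  have hmain := norm_period_main_sub_le hd hμ
  have hexact := integral_sin_mul_sqrt (ρ := 2 / 3 - μ - d) (by linarith)
  have hδ := norm_nonneg d
  set L := ∫ θ in (0 : ℝ)..(Real.pi / 2), logIntegrand d μ θ with hL
  have hc0 : ∀ θ : ℝ, 1 / 4 ≤ (8 / 3 - (2 / 3 - μ - d) * (Real.cos θ : ℂ) ^ 2).re := by
    intro θ
    have h1 := cofactor_re_bound hd hμ (Real.cos θ) (Real.cos_sq_le_one θ)
    have h2 := abs_le.mp (abs_re_le_norm μ)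
    have h3 : (8 / 3 + 2 * μ - (2 / 3 - μ - d) * (Real.cos θ : ℂ) ^ 2).re
        = (8 / 3 - (2 / 3 - μ - d) * (Real.cos θ : ℂ) ^ 2).re + 2 * μ.re := by
      simp only [sub_re, add_re]; norm_num; ring
    nlinarith
  have c0 : Continuous fun θ : ℝ =>
      Complex.sqrt (8 / 3 - (2 / 3 - μ - d) * (Real.cos θ : ℂ) ^ 2) :=
    continuousOn_sqrt_re_nonneg.comp_continuous (by fun_prop) fun θ => by
      have := hc0 θ
      show (0 : ℝ) ≤ _; linarith
  set u := Complex.sqrt (2 / 3 - μ - d) with hu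
  set ρ := 2 / 3 - μ - d with hρdef
  set g := cofactorSqrt d μ with hg
  set g₀ : ℝ → ℂ := fun θ => Complex.sqrt (8 / 3 - ρ * (Real.cos θ : ℂ) ^ 2) with hg₀
  set E : ℝ → ℂ := fun θ => (Real.sin θ : ℂ) * ((d + ρ * (Real.sin θ : ℂ) ^ 2) * g θ
    - (2 / 3 - ρ * (Real.cos θ : ℂ) ^ 2) * g₀ θ) with hE
  -- One factor `√ρ` is moved into `sum_sqrt_identity`, leaving an exactly integrable part, a
  -- remainder `E` and the logarithmic part.
  have hpt : ∀ θ ∈ Set.uIcc 0 (Real.pi / 2), ρ * ((Real.sin θ : ℂ) ^ 2 *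
      (Complex.sqrt (2 * d + ρ * (Real.sin θ : ℂ) ^ 2) * g θ))
      = u * ((Real.sin θ : ℂ) * (2 / 3 - ρ * (Real.cos θ : ℂ) ^ 2) * g₀ θ) + u * E θ
        - d ^ 2 * logIntegrand d μ θ := by
    intro θ hθ
    rw [Set.uIcc_of_le (by positivity)] at hθ
    have hid := sum_sqrt_identity hd hμ hre (hmem θ hθ)
    rw [← sumSqrtSq] at hid
    simp only [hE, logIntegrand]
    linear_combination (-((Real.sin θ : ℂ) ^ 2 *
      (Complex.sqrt (2 * d + ρ * (Real.sin θ : ℂ) ^ 2) * g θ))) * hu2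
      + u * (Real.sin θ : ℂ) * g θ * hid
  have hEc : Continuous E := by simp only [hE]; fun_prop
  have hEn : ‖∫ θ in (0 : ℝ)..(Real.pi / 2), E θ‖ ≤ 15 * ‖d‖ ^ 2 * |Real.pi / 2 - 0| := by
    refine intervalIntegral.norm_integral_le_of_norm_le_const fun θ _ => ?_
    -- Since `ρ + d = 2/3 - μ`, the two polynomial factors differ only by `μ`, so `E` is of order
    -- `‖d‖²`.
    have e1 : E θ = (Real.sin θ : ℂ) * ((2 / 3 - ρ * (Real.cos θ : ℂ) ^ 2) * (g θ - g₀ θ)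
        - μ * g θ) := by
      have hsc : (Real.sin θ : ℂ) ^ 2 = 1 - (Real.cos θ : ℂ) ^ 2 := by
        rw [← ofReal_pow, Real.sin_sq]; push_cast; ring
      simp only [hE]
      rw [hsc, hρdef]; ring
    have n1 : ‖g θ - g₀ θ‖ ≤ 4 * ‖d‖ ^ 2 := by
      refine (norm_sqrt_sub_sqrt_le _ (hc0 θ)).trans ?_
      rw [show 8 / 3 + 2 * μ - ρ * (Real.cos θ : ℂ) ^ 2 - (8 / 3 - ρ * (Real.cos θ : ℂ) ^ 2)
        = 2 * μ by ring, norm_mul]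
      simp only [Complex.norm_ofNat]
      linarith
    have n2 : ‖g θ‖ ≤ 7 := by
      have h1 := norm_sqrt_cofactor_sub_le hd hμ θ
      have h2 := norm_sub_norm_le (g θ) (√2 : ℝ)
      rw [norm_real, Real.norm_eq_abs, abs_of_nonneg (Real.sqrt_nonneg _)] at h2
      have h3 : √2 ≤ 3 / 2 := Real.sqrt_le_iff.mpr (by norm_num)
      have h4 := Real.sin_sq_le_one θ
      change ‖g θ - _‖ ≤ _ at h1
      linarith
    have n3 : ‖2 / 3 - ρ * (Real.cos θ : ℂ) ^ 2‖ ≤ 2 := by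
      refine (norm_sub_le _ _).trans ?_
      rw [norm_mul, norm_pow, norm_real, Real.norm_eq_abs, sq_abs]
      have := Real.cos_sq_le_one θ
      norm_num
      nlinarith [sq_nonneg (Real.cos θ), norm_nonneg ρ]
    have n4 : ‖(Real.sin θ : ℂ)‖ ≤ 1 := by
      rw [norm_real, Real.norm_eq_abs]; exact Real.abs_sin_le_one θ
    rw [e1, norm_mul]
    have n5 := norm_sub_le ((2 / 3 - ρ * (Real.cos θ : ℂ) ^ 2) * (g θ - g₀ θ)) (μ * g θ)
    rw [norm_mul, norm_mul] at n5
    have n6 : ‖2 / 3 - ρ * (Real.cos θ : ℂ) ^ 2‖ * ‖g θ - g₀ θ‖ ≤ 2 * (4 * ‖d‖ ^ 2) := by gcongr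
    have n7 : ‖μ‖ * ‖g θ‖ ≤ ‖d‖ ^ 2 * 7 := by gcongr
    calc _ ≤ 1 * (15 * ‖d‖ ^ 2) := by gcongr; linarith
      _ = _ := one_mul _
  have hLi : IntervalIntegrable (fun θ => d ^ 2 * logIntegrand d μ θ) volume 0 (Real.pi / 2) := by
    rcases eq_or_ne d 0 with h0 | hd0
    · simp [h0]
    · exact (intervalIntegrable_logIntegrand hd hμ hre hd0).const_mul _
  rw [← intervalIntegral.integral_const_mul, intervalIntegral.integral_congr hpt,
    intervalIntegral.integral_sub (Continuous.intervalIntegrable (by fun_prop) _ _) hLi,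
    intervalIntegral.integral_add (Continuous.intervalIntegrable (by fun_prop) _ _)
      (Continuous.intervalIntegrable (by fun_prop) _ _),
    intervalIntegral.integral_const_mul, intervalIntegral.integral_const_mul,
    intervalIntegral.integral_const_mul, hexact, ← hL]
  have hlogpart : ‖d ^ 2 * (L + (√3 / 4 * Real.log ‖d‖ : ℝ))‖ ≤ 600 * ‖d‖ ^ 2 := by
    rcases eq_or_ne d 0 with rfl | hd0
    · simp
    · rw [norm_mul, norm_pow, mul_comm]
      gcongr
      exact norm_integral_logIntegrand_sub_le hd hμ hre hd0
  have hun' : ‖u‖ ≤ 2 := by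
    have h2 := norm_sub_norm_le u (√(2 / 3) : ℝ)
    rw [norm_real, Real.norm_eq_abs, abs_of_nonneg (Real.sqrt_nonneg _)] at h2
    have h3 : √(2 / 3) ≤ 1 := Real.sqrt_le_iff.mpr (by norm_num)
    linarith
  have hE2 : ‖u * ∫ θ in (0 : ℝ)..(Real.pi / 2), E θ‖ ≤ 50 * ‖d‖ ^ 2 := by
    rw [sub_zero, abs_of_pos (by positivity)] at hEn
    rw [norm_mul]
    calc _ ≤ 2 * (15 * ‖d‖ ^ 2 * (Real.pi / 2)) := by gcongr
      _ ≤ _ := by nlinarith [sq_nonneg ‖d‖]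
  calc _ = ‖(u * ((8 / 3 - ρ) * Complex.sqrt (8 / 3 - ρ) / 4) - (1 / √3 : ℝ))
      + u * (∫ θ in (0 : ℝ)..(Real.pi / 2), E θ)
      + -(d ^ 2 * (L + (√3 / 4 * Real.log ‖d‖ : ℝ)))‖ := by congr 1; ring
    _ ≤ _ := norm_add₃_le
    _ ≤ _ := by rw [norm_neg]; linarith [sq_nonneg ‖d‖]
end nearlyDouble

/-! ### Solving the two real equations for `ε` in terms of `φ`. -/

lemma IsRootTriple.nearlyDouble {A d μ : ℂ}
    (h : IsRootTriple A (-2 / 3 + μ + d) (-2 / 3 + μ - d) (-8 / 3 - 2 * μ)) :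
    d ^ 2 = -4 * μ - 3 * μ ^ 2 ∧ A = 8 / 27 + 2 * μ * (1 + μ) ^ 2 := by
  have h1 : d ^ 2 = -4 * μ - 3 * μ ^ 2 := by linear_combination -h.sum_mul
  refine ⟨h1, ?_⟩
  linear_combination (1 / 4 : ℂ) * h.prod - (2 / 3 + μ / 2) * h1

lemma SolvesBoutroux.abs_sin_add_le {φ : ℝ} {A d μ : ℂ} (hS : SolvesBoutroux φ A)
    (h : IsRootTriple A (-2 / 3 + μ + d) (-2 / 3 + μ - d) (-8 / 3 - 2 * μ))
    (hd : ‖d‖ ≤ 1 / 100) (hμ : ‖μ‖ ≤ ‖d‖ ^ 2) (hre : 0 ≤ d.re) :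
    |Real.sin (2 * φ) / √3 + √3 / 4 * Real.log ‖d‖ * (exp (2 * I * φ) * d ^ 2).im|
      ≤ 700 * ‖d‖ ^ 2 := by
  have hρ := rho_re_mem hd hμ
  have hμre := abs_le.mp (abs_re_le_norm μ)
  have e1 : ∀ s : ℝ, (((-2 / 3 + μ + d) * (s : ℂ) - (-2 / 3 + μ - d)).re)
      = 2 * d.re * s + (2 / 3 - μ + d).re * (1 - s) := by
    intro s
    simp only [sub_re, add_re, re_mul_ofReal]
    norm_num
    ring
  have c1 : ContinuousOn (fun s : ℝ =>
      Complex.sqrt ((-2 / 3 + μ + d) * (s : ℂ) - (-2 / 3 + μ - d))) (Set.Icc 0 1) := by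
    refine continuousOn_sqrt_re_nonneg.comp (by fun_prop) fun s hs => ?_
    show (0 : ℝ) ≤ _
    have h2 : 0 ≤ (2 / 3 - μ + d).re := by
      simp only [sub_re, add_re] at hρ ⊢
      linarith
    rw [e1]
    exact add_nonneg (mul_nonneg (by linarith) hs.1) (mul_nonneg h2 (by linarith [hs.2]))
  have e2 : ∀ s : ℝ, 0 ≤ s → (-2 / 3 + μ + d) * (s : ℂ) - (-8 / 3 - 2 * μ)
      = 8 / 3 + 2 * μ - (2 / 3 - μ - d) * ((√s : ℝ) : ℂ) ^ 2 := by
    intro s hs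
    rw [← ofReal_pow, Real.sq_sqrt hs]; ring
  have c2 : ContinuousOn (fun s : ℝ =>
      Complex.sqrt ((-2 / 3 + μ + d) * (s : ℂ) - (-8 / 3 - 2 * μ))) (Set.Icc 0 1) := by
    refine continuousOn_sqrt_re_nonneg.comp (by fun_prop) fun s hs => ?_
    show (0 : ℝ) ≤ _
    have := cofactor_re_bound hd hμ (√s) (by rw [Real.sq_sqrt hs.1]; exact hs.2)
    rw [e2 s hs.1]
    linarith
  have key := hS.im_period_zero_root h.quartic
    (fun s => Complex.sqrt ((-2 / 3 + μ + d) * (s : ℂ) - (-2 / 3 + μ - d)) *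
      Complex.sqrt ((-2 / 3 + μ + d) * (s : ℂ) - (-8 / 3 - 2 * μ))) (c1.mul c2)
    (fun s _ => by simp only [mul_pow, sqrt_sq_eq])
  have e3 : ∀ θ : ℝ, Complex.sqrt ((-2 / 3 + μ + d) * ((Real.cos θ ^ 2 : ℝ) : ℂ)
        - (-2 / 3 + μ - d)) * Complex.sqrt ((-2 / 3 + μ + d) * ((Real.cos θ ^ 2 : ℝ) : ℂ)
        - (-8 / 3 - 2 * μ))
      = Complex.sqrt (2 * d + (2 / 3 - μ - d) * (Real.sin θ : ℂ) ^ 2) * cofactorSqrt d μ θ := by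
    intro θ
    unfold cofactorSqrt
    congr 2
    · rw [Real.cos_sq']; push_cast; ring
    · push_cast; ring
  simp_rw [e3] at key
  have hn := norm_period_sub_le hd hμ hre
  set J := ∫ θ in (0 : ℝ)..(Real.pi / 2), (Real.sin θ : ℂ) ^ 2 *
      (Complex.sqrt (2 * d + (2 / 3 - μ - d) * (Real.sin θ : ℂ) ^ 2) * cofactorSqrt d μ θ)
  set V : ℂ := (1 / √3 : ℝ) + d ^ 2 * (√3 / 4 * Real.log ‖d‖ : ℝ) with hV
  have hexp : exp (2 * I * φ) = exp ((2 * φ : ℝ) * I) := by congr 1; push_cast; ring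
  have hen : ‖exp (2 * I * φ)‖ = 1 := by rw [hexp, norm_exp_ofReal_mul_I]
  have hVim : (exp (2 * I * φ) * V).im
      = Real.sin (2 * φ) / √3 + √3 / 4 * Real.log ‖d‖ * (exp (2 * I * φ) * d ^ 2).im := by
    rw [hV, mul_add, ← mul_assoc, add_im, im_mul_ofReal, im_mul_ofReal, hexp, exp_ofReal_mul_I_im]
    ring
  rw [← hVim]
  have : (exp (2 * I * φ) * V).im
      = -(exp (2 * I * φ) * ((2 / 3 - μ - d) * J - V)).im := by
    have hz : (exp (2 * I * φ) * ((2 / 3 - μ - d) * J)).im = 0 := by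
      rw [show exp (2 * I * φ) * ((2 / 3 - μ - d) * J)
        = -(exp (2 * I * φ) * ((-2 / 3 + μ + d) * J)) by ring, neg_im, key, neg_zero]
    rw [mul_sub, sub_im, hz]; ring
  rw [this, abs_neg]
  refine (abs_im_le_norm _).trans ?_
  rw [norm_mul, hen, one_mul]
  exact hn

/-- Inversion of the real equation `sin 2φ / √3 = (√3 / 4) a y + O(D²)`, where `|y| ≍ D²` and
`D = e⁻ᵃ`. -/
lemma inversion_bounds {φ y a D : ℝ} (ha : 100000 ≤ a) (hφ : |φ| ≤ 1 / 100)
    (h1 : |Real.sin (2 * φ) / √3 + √3 / 4 * (-a) * y| ≤ 700 * D ^ 2)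
    (h2 : D ^ 2 / 2 ≤ |y|) (h3 : |y| ≤ D ^ 2) :
    a * D ^ 2 ≤ 12 * |φ| ∧ |φ| ≤ a * D ^ 2 ∧
      |a * y - 8 / 3 * φ| ≤ 11 * |φ| ^ 3 + 1700 * D ^ 2 := by
  have ha0 : 0 < a := by linarith
  have hφ0 := abs_nonneg φ
  have t3 : √3 ^ 2 = 3 := Real.sq_sqrt (by norm_num)
  have t3' : 0 < √3 := by positivity
  have t3'' : 3 / 2 ≤ √3 := Real.le_sqrt_of_sq_le (by norm_num)
  have hsin : |Real.sin (2 * φ) - 2 * φ| ≤ 8 * |φ| ^ 3 := by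
    have hx : |2 * φ| = 2 * |φ| := by rw [abs_mul]; norm_num
    have hb := Real.sin_bound (x := 2 * φ) (by rw [hx]; linarith)
    rw [hx] at hb
    have h4 : |(2 * φ) ^ 3 / 6| = 8 * |φ| ^ 3 / 6 := by
      rw [abs_div, abs_pow, hx]; norm_num; ring
    have h5 := abs_add_le (Real.sin (2 * φ) - (2 * φ - (2 * φ) ^ 3 / 6)) (-((2 * φ) ^ 3 / 6))
    rw [abs_neg, h4] at h5
    rw [show Real.sin (2 * φ) - (2 * φ - (2 * φ) ^ 3 / 6) + -((2 * φ) ^ 3 / 6)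
      = Real.sin (2 * φ) - 2 * φ by ring] at h5
    have h6 : |φ| ^ 5 ≤ |φ| ^ 3 := pow_le_pow_of_le_one hφ0 (by linarith) (by norm_num)
    have h7 : 0 ≤ |φ| ^ 3 := by positivity
    have h8 : (2 * |φ|) ^ 5 = 32 * |φ| ^ 5 := by ring
    rw [h8] at hb
    linarith
  have hy : |a * y - 8 / 3 * φ| ≤ 11 * |φ| ^ 3 + 1700 * D ^ 2 := by
    have e : a * y - 8 / 3 * φ = 4 / 3 * (Real.sin (2 * φ) - 2 * φ)
        - 4 / √3 * (Real.sin (2 * φ) / √3 + √3 / 4 * (-a) * y) := by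
      field_simp
      rw [t3]; ring
    -- Chosen because `17/7 · 700 = 1700`.
    have hk : 4 / √3 ≤ 17 / 7 := by
      rw [div_le_iff₀ t3']
      have : (28 : ℝ) / 17 ≤ √3 := Real.le_sqrt_of_sq_le (by norm_num)
      linarith
    rw [e]
    refine (abs_sub _ _).trans ?_
    rw [abs_mul, abs_mul, abs_of_pos (show (0 : ℝ) < 4 / 3 by norm_num),
      abs_of_pos (show 0 < 4 / √3 by positivity)]
    have : 4 / √3 * |Real.sin (2 * φ) / √3 + √3 / 4 * (-a) * y| ≤ 17 / 7 * (700 * D ^ 2) := by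
      gcongr
    have : 0 ≤ |φ| ^ 3 := by positivity
    linarith
  have hcube : |φ| ^ 3 ≤ |φ| / 10000 := by
    have : |φ| ^ 2 ≤ (1 / 100) ^ 2 := by gcongr
    have : |φ| ^ 3 = |φ| * |φ| ^ 2 := by ring
    nlinarith
  have habs1 := abs_sub_abs_le_abs_sub (a * y) (8 / 3 * φ)
  have habs2 := abs_sub_abs_le_abs_sub (8 / 3 * φ) (a * y)
  rw [abs_sub_comm] at habs2
  rw [abs_mul, abs_mul, abs_of_pos ha0, abs_of_pos (show (0 : ℝ) < 8 / 3 by norm_num)]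
    at habs1 habs2
  have m1 : a * (D ^ 2 / 2) ≤ a * |y| := by gcongr
  have m2 : a * |y| ≤ a * D ^ 2 := by gcongr
  have m3 : 100000 * D ^ 2 ≤ a * D ^ 2 := by gcongr
  exact ⟨by linarith, by linarith, hy⟩

/-- `|φ|` is `a e^{-2a}` up to bounded factors; take logarithms. -/
lemma log_bounds {φ a : ℝ} (ha : 100000 ≤ a) (h1 : a * Real.exp (-a) ^ 2 ≤ 12 * |φ|)
    (h2 : |φ| ≤ a * Real.exp (-a) ^ 2) :
    |Real.log |φ| + 2 * a| ≤ Real.log a + 3 ∧ a ≤ abs (Real.log |φ|) ∧ abs (Real.log |φ|) ≤ 3 * a ∧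
      1 ≤ Real.log a ∧ Real.log |φ| < 0 := by
  have ha0 : 0 < a := by linarith
  have he : 0 < Real.exp (-a) := Real.exp_pos _
  have hφ : 0 < |φ| := by
    have : 0 < a * Real.exp (-a) ^ 2 := by positivity
    linarith
  have hlog : Real.log (a * Real.exp (-a) ^ 2) = Real.log a - 2 * a := by
    rw [Real.log_mul ha0.ne' (by positivity), Real.log_pow, Real.log_exp]; push_cast; ring
  have l2 := Real.log_le_log hφ h2
  have l1 := Real.log_le_log (by positivity) h1
  rw [Real.log_mul (by norm_num) hφ.ne', hlog] at l1
  rw [hlog] at l2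
  have l12 : Real.log 12 ≤ 3 := by
    rw [Real.log_le_iff_le_exp (by norm_num)]
    have h := Real.exp_one_gt_d9
    have : Real.exp 3 = Real.exp 1 ^ 3 := by rw [← Real.exp_nat_mul]; norm_num
    rw [this]
    calc (12 : ℝ) ≤ 2.7 ^ 3 := by norm_num
      _ ≤ Real.exp 1 ^ 3 := by gcongr; linarith
  have la1 : 1 ≤ Real.log a := by
    rw [Real.le_log_iff_exp_le ha0]
    linarith [Real.exp_one_lt_d9]
  have la2 : Real.log a + 3 ≤ a := by
    have := Real.log_le_sub_one_of_pos (show 0 < a / 8 by positivity)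
    rw [Real.log_div ha0.ne' (by norm_num)] at this
    have h8 : Real.log 8 ≤ 7 := by
      have := Real.log_le_sub_one_of_pos (show (0 : ℝ) < 8 by norm_num)
      linarith
    linarith
  have hab : |Real.log |φ| + 2 * a| ≤ Real.log a + 3 := abs_le.mpr ⟨by linarith, by linarith⟩
  have hneg : Real.log |φ| < 0 := by linarith
  rw [abs_of_neg hneg]
  exact ⟨hab, by linarith, by linarith, la1, hneg⟩

/-- The state of affairs for one small angle: `ζ₁,₃ = -2/3 + μ ± d`. -/
structure LocalAsymptotics (φ : ℝ) (ε d μ : ℂ) : Prop where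
  ne_zero : d ≠ 0
  re_nonneg : 0 ≤ d.re
  norm_le : ‖d‖ ≤ 1 / 1000
  norm_mu : ‖μ‖ ≤ ‖d‖ ^ 2
  sq_eq : d ^ 2 = -4 * μ - 3 * μ ^ 2
  eps_eq : ε = 2 * μ * (1 + μ) ^ 2
  im_pos : φ < 0 → ‖d‖ ^ 2 / 5 ≤ ε.im
  im_neg : 0 < φ → ε.im ≤ -(‖d‖ ^ 2 / 5)
  log_ne : Real.log |φ| ≠ 0
  rel : ‖ε / (8 * I / 3 * ((φ / Real.log |φ| : ℝ) : ℂ)) - 1‖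
    ≤ 150000 * abs (Real.log (abs (Real.log |φ|)) / Real.log |φ|)

/-- The first term is the cost of replacing `-2a` by `P = log |φ|` and dominates; the second
collects the errors in `a y ≈ 8φ/3` and `ε ≈ -iy/2`. -/
lemma relative_error_identity (e : ℂ) (y : ℝ) {φ P a : ℝ} (hφ : φ ≠ 0) (hP : P ≠ 0)
    (ha : a ≠ 0) :
    (e - I * y / 2) / (8 * I / 3 * ((φ / P : ℝ) : ℂ)) - 1
      = ((-(P + 2 * a) / (2 * a) : ℝ) : ℂ)
        + (((-(a * y - 8 / 3 * φ) / (2 * a)) : ℝ) * I + e) * (3 * P / (8 * I * φ)) := by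
  have hPne : (P : ℂ) ≠ 0 := by exact_mod_cast hP
  have hφne : (φ : ℂ) ≠ 0 := by exact_mod_cast hφ
  have hane : (a : ℂ) ≠ 0 := by exact_mod_cast ha
  have hI := I_ne_zero
  push_cast
  field_simp
  ring

/-- The error of `ε ≈ -iy/2`: `ε = -d²/2 + O(|d|⁴)`, `d² = e^{-2iφ} w`, and `w = iy + O(|d|³)`. -/
lemma norm_eps_add_le {φ : ℝ} {d μ : ℂ} (hsq : d ^ 2 = -4 * μ - 3 * μ ^ 2)
    (hμ : ‖μ‖ ≤ ‖d‖ ^ 2) (hμ1 : ‖μ‖ ≤ 1) (hd1 : ‖d‖ ≤ 1 / 100000)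
    (hw1 : |(exp (2 * I * φ) * d ^ 2).re| ≤ 24 * ‖d‖ ^ 3) :
    ‖2 * μ * (1 + μ) ^ 2 + I * (exp (2 * I * φ) * d ^ 2).im / 2‖
      ≤ |φ| * ‖d‖ ^ 2 + 13 * ‖d‖ ^ 3 := by
  have hexp : exp (2 * I * φ) = exp ((2 * φ : ℝ) * I) := by congr 1; push_cast; ring
  have hwn : ‖exp (2 * I * φ) * d ^ 2‖ = ‖d‖ ^ 2 := by
    rw [norm_mul, norm_pow, hexp, norm_exp_ofReal_mul_I, one_mul]
  set w := exp (2 * I * φ) * d ^ 2 with hw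
  set D := ‖d‖
  have hD0 : 0 ≤ D := norm_nonneg d
  set y := w.im
  have hd2 : d ^ 2 = exp ((-(2 * φ) : ℝ) * I) * w := by
    rw [hw, ← mul_assoc, hexp, ← exp_add]
    push_cast
    ring_nf
    simp
  have hwre : w = w.re + y * I := (re_add_im w).symm
  have e1 : 2 * μ * (1 + μ) ^ 2 + I * y / 2 = (5 / 2 * μ ^ 2 + 2 * μ ^ 3) - (exp ((-(2 * φ) : ℝ) * I) - 1) * w / 2
      - w.re / 2 := by
    have : I * (y : ℂ) / 2 = w / 2 - w.re / 2 := by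
      conv_rhs => rw [hwre]
      simp; ring
    rw [this]
    linear_combination (1 / 2 : ℂ) * hsq - (1 / 2 : ℂ) * hd2
  have n1 : ‖5 / 2 * μ ^ 2 + 2 * μ ^ 3‖ ≤ 5 * D ^ 4 := by
    refine (norm_add_le _ _).trans ?_
    rw [norm_mul, norm_mul, norm_pow, norm_pow]
    have q1 : ‖μ‖ ^ 2 ≤ D ^ 4 := by
      calc ‖μ‖ ^ 2 ≤ (D ^ 2) ^ 2 := by gcongr
        _ = D ^ 4 := by ring
    have q2 : ‖μ‖ ^ 3 ≤ ‖μ‖ ^ 2 := pow_le_pow_of_le_one (norm_nonneg _) hμ1 (by norm_num)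
    have q3 : ‖(5 / 2 : ℂ)‖ = 5 / 2 := by norm_num
    rw [q3, Complex.norm_ofNat]
    linarith [pow_nonneg hD0 4]
  have n2 : ‖(exp ((-(2 * φ) : ℝ) * I) - 1) * w / 2‖ ≤ |φ| * D ^ 2 := by
    rw [norm_div, norm_mul, hwn]
    have q := Real.norm_exp_I_mul_ofReal_sub_one_le (x := -(2 * φ))
    rw [mul_comm I, Real.norm_eq_abs, abs_neg, abs_mul, abs_two] at q
    simp only [Complex.norm_ofNat]
    nlinarith [sq_nonneg D]
  have n3 : ‖(w.re : ℂ) / 2‖ ≤ 12 * D ^ 3 := by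
    rw [norm_div, norm_real, Real.norm_eq_abs]
    simp only [Complex.norm_ofNat]
    linarith
  rw [e1]
  have m1 := norm_sub_le ((5 / 2 * μ ^ 2 + 2 * μ ^ 3) - (exp ((-(2 * φ) : ℝ) * I) - 1) * w / 2)
    ((w.re : ℂ) / 2)
  have m2 := norm_sub_le (5 / 2 * μ ^ 2 + 2 * μ ^ 3) ((exp ((-(2 * φ) : ℝ) * I) - 1) * w / 2)
  have : 5 * D ^ 4 ≤ D ^ 3 := by
    have : D ^ 4 = D ^ 3 * D := by ring
    have : 0 ≤ D ^ 3 := by positivity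
    nlinarith
  linarith

lemma norm_relative_error_le {e : ℂ} {y φ P a D : ℝ} (hφ0 : φ ≠ 0) (hφ : |φ| ≤ 1 / 100)
    (ha1 : 100000 ≤ a) (hD0 : 0 < D) (hDa1 : D * a ≤ 1) (b1 : a * D ^ 2 ≤ 12 * |φ|)
    (b2 : |φ| ≤ a * D ^ 2) (b3 : |a * y - 8 / 3 * φ| ≤ 11 * |φ| ^ 3 + 1700 * D ^ 2)
    (l1 : |P + 2 * a| ≤ Real.log a + 3) (l2 : a ≤ |P|) (l3 : |P| ≤ 3 * a)
    (l4 : 1 ≤ Real.log a) (l5 : P < 0) (hen : ‖e‖ ≤ |φ| * D ^ 2 + 13 * D ^ 3) :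
    ‖(e - I * y / 2) / (8 * I / 3 * ((φ / P : ℝ) : ℂ)) - 1‖
      ≤ 150000 * abs (Real.log |P| / P) := by
  have ha0 : 0 < a := by linarith
  have hφp : 0 < |φ| := abs_pos.mpr hφ0
  rw [relative_error_identity e y hφ0 l5.ne ha0.ne']
  have q1 : ‖((-(P + 2 * a) / (2 * a) : ℝ) : ℂ)‖ ≤ 2 * Real.log a / a := by
    rw [norm_real, Real.norm_eq_abs, abs_div, abs_neg, abs_of_pos (show 0 < 2 * a by linarith),
      div_le_div_iff₀ (by linarith) ha0]
    nlinarith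
  have q2 : ‖3 * (P : ℂ) / (8 * I * φ)‖ ≤ 9 / 8 * (a / |φ|) := by
    rw [norm_div, norm_mul, norm_mul, norm_mul, norm_I, norm_real, norm_real, Real.norm_eq_abs,
      Real.norm_eq_abs]
    simp only [Complex.norm_ofNat, mul_one]
    rw [div_le_iff₀ (by positivity)]
    field_simp
    linarith
  have q3 : ‖((-(a * y - 8 / 3 * φ) / (2 * a) : ℝ) : ℂ) * I + e‖
      ≤ 40000 * |φ| / a ^ 2 := by
    refine (norm_add_le _ _).trans ?_
    rw [norm_mul, norm_I, mul_one, norm_real, Real.norm_eq_abs, abs_div, abs_neg,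
      abs_of_pos (show 0 < 2 * a by linarith)]
    have hD2 : D ^ 2 ≤ 12 * |φ| / a := by rw [le_div_iff₀ ha0]; linarith
    have hφa : |φ| * a ≤ 1 := by
      calc |φ| * a ≤ a * D ^ 2 * a := by gcongr
        _ = (D * a) ^ 2 := by ring
        _ ≤ 1 := pow_le_one₀ (by positivity) hDa1
    have k1 : |a * y - 8 / 3 * φ| / (2 * a) ≤ 21000 * |φ| / a ^ 2 := by
      rw [div_le_div_iff₀ (by linarith) (by positivity)]
      have : 11 * |φ| ^ 3 * a ≤ 11 * |φ| := by
        have : |φ| ^ 3 * a = |φ| * (|φ| * (|φ| * a)) := by ring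
        have : |φ| * (|φ| * a) ≤ 1 * 1 := by gcongr; linarith
        nlinarith
      have hb : |a * y - 8 / 3 * φ| * a ≤ 21000 * |φ| := by nlinarith
      nlinarith
    have k2 : ‖e‖ ≤ 169 * |φ| / a ^ 2 := by
      rw [le_div_iff₀ (by positivity)]
      have hDa2 : D ^ 2 * a ^ 2 ≤ 1 := by
        rw [← mul_pow]; exact pow_le_one₀ (by positivity) hDa1
      have : D ^ 3 * a ^ 2 ≤ 12 * |φ| := by
        have : D ^ 3 * a ^ 2 = (a * D ^ 2) * (D * a) := by ring
        rw [this]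
        calc _ ≤ (12 * |φ|) * 1 := by gcongr
          _ = _ := mul_one _
      calc ‖e‖ * a ^ 2 ≤ (|φ| * D ^ 2 + 13 * D ^ 3) * a ^ 2 := by gcongr
        _ = |φ| * (D ^ 2 * a ^ 2) + 13 * (D ^ 3 * a ^ 2) := by ring
        _ ≤ _ := by nlinarith
    have : 21000 * |φ| / a ^ 2 + 169 * |φ| / a ^ 2 ≤ 40000 * |φ| / a ^ 2 := by
      rw [← add_div]; gcongr; linarith
    linarith
  have q4 : Real.log a / a ≤ 3 * abs (Real.log |P| / P) := by
    rw [abs_div, div_le_iff₀ ha0]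
    have : Real.log a ≤ Real.log |P| := Real.log_le_log ha0 l2
    rw [abs_of_nonneg (by linarith), mul_assoc, div_mul_eq_mul_div, ← mul_div_assoc,
      le_div_iff₀ (by linarith)]
    nlinarith
  refine (norm_add_le _ _).trans ?_
  rw [norm_mul]
  have q5 : ‖((-(a * y - 8 / 3 * φ) / (2 * a) : ℝ) : ℂ) * I + e‖ *
      ‖3 * (P : ℂ) / (8 * I * φ)‖ ≤ 45000 * (Real.log a / a) := by
    calc _ ≤ 40000 * |φ| / a ^ 2 * (9 / 8 * (a / |φ|)) := by gcongr
      _ = 45000 * (1 / a) := by field_simp; norm_num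
      _ ≤ _ := by gcongr
  have : 2 * Real.log a / a = 2 * (Real.log a / a) := by ring
  exact (add_le_add q1 q5).trans (by linarith [abs_nonneg (Real.log |P| / P)])

lemma SolvesBoutroux.localAsymptotics {φ : ℝ} {A d μ : ℂ} (hS : SolvesBoutroux φ A)
    (h : IsRootTriple A (-2 / 3 + μ + d) (-2 / 3 + μ - d) (-8 / 3 - 2 * μ))
    (hre : 0 ≤ d.re) (hd : ‖d‖ ≤ Real.exp (-100000)) (hμ1 : ‖μ‖ ≤ 1) (hφ : |φ| ≤ 1 / 100)
    (hφ0 : φ ≠ 0) : LocalAsymptotics φ (A - 8 / 27) d μ := by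
  obtain ⟨hsq, hA⟩ := h.nearlyDouble
  have hexpa : ∀ a : ℝ, 0 < a → Real.exp (-a) ≤ 1 / a := by
    intro a ha
    rw [Real.exp_neg, one_div]
    exact inv_anti₀ ha (by linarith [Real.add_one_le_exp a])
  have hd1 : ‖d‖ ≤ 1 / 100000 := hd.trans (hexpa _ (by norm_num))
  have hμ : ‖μ‖ ≤ ‖d‖ ^ 2 := by
    have e1 : d ^ 2 = -(μ * (4 + 3 * μ)) := by rw [hsq]; ring
    have e2 := norm_sub_norm_le 4 (-(3 * μ))
    rw [sub_neg_eq_add, norm_neg, norm_mul] at e2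
    simp only [Complex.norm_ofNat] at e2
    rw [← norm_pow, e1, norm_neg, norm_mul]
    nlinarith [norm_nonneg μ]
  have hε : A - 8 / 27 = 2 * μ * (1 + μ) ^ 2 := by rw [hA]; ring
  have hw1 := hS.abs_re_le h (by linarith) hμ
  have hw2 := hS.abs_sin_add_le h (by linarith) hμ hre
  set w := exp (2 * I * φ) * d ^ 2 with hw
  set D := ‖d‖ with hD
  -- For `d = 0` the period equation would read `sin 2φ = 0`, impossible for small `φ ≠ 0`.
  have hD0 : 0 < D := by
    refine lt_of_le_of_ne (norm_nonneg d) fun h0 => ?_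
    have hdz : d = 0 := norm_eq_zero.mp h0.symm
    have hz : Real.sin (2 * φ) = 0 := by
      rw [hw, hdz, ← h0] at hw2
      simpa using hw2
    have hx := abs_le.mp hφ
    rw [Real.sin_eq_zero_iff_of_lt_of_lt (by linarith [Real.pi_gt_three])
      (by linarith [Real.pi_gt_three])] at hz
    exact hφ0 (by linarith)
  have hexp : exp (2 * I * φ) = exp ((2 * φ : ℝ) * I) := by congr 1; push_cast; ring
  have hwn : ‖w‖ = D ^ 2 := by
    rw [hw, norm_mul, norm_pow, hexp, norm_exp_ofReal_mul_I, one_mul]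
  set y := w.im with hy
  have hy1 : |y| ≤ D ^ 2 := hwn ▸ abs_im_le_norm w
  have hD3 : 24 * D ^ 3 ≤ D ^ 2 / 1000 := by
    have : D ^ 3 = D ^ 2 * D := by ring
    nlinarith [sq_nonneg D]
  have hy2 : D ^ 2 / 2 ≤ |y| := by
    have := norm_le_abs_re_add_abs_im w
    rw [hwn] at this
    nlinarith [sq_nonneg D]
  set a := -Real.log D with ha
  have hDa : D = Real.exp (-a) := by rw [ha, neg_neg, Real.exp_log hD0]
  -- Large enough for `a D²` to absorb the error `1700 D²`.
  have ha1 : 100000 ≤ a := by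
    have := Real.log_le_log hD0 hd
    rw [Real.log_exp] at this
    linarith
  have ha0 : 0 < a := by linarith
  rw [show Real.log D = -a by rw [ha, neg_neg]] at hw2
  obtain ⟨b1, b2, b3⟩ := inversion_bounds ha1 hφ hw2 hy2 hy1
  obtain ⟨l1, l2, l3, l4, l5⟩ := log_bounds ha1 (by rw [← hDa]; exact b1)
    (by rw [← hDa]; exact b2)
  set P := Real.log |φ| with hP
  have hφp : 0 < |φ| := abs_pos.mpr hφ0
  have hDle : D ≤ 1 / a := hDa ▸ hexpa a ha0
  have hDa1 : D * a ≤ 1 := by rwa [le_div_iff₀ ha0] at hDle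
  set e := (A - 8 / 27) + I * y / 2 with he
  have hen : ‖e‖ ≤ |φ| * D ^ 2 + 13 * D ^ 3 := by
    rw [he, hε]
    exact norm_eps_add_le hsq hμ hμ1 hd1
      ((hw1 : |w.re| ≤ 24 * D ^ 3))
  have heD : ‖e‖ ≤ D ^ 2 / 50 := by
    have : |φ| * D ^ 2 ≤ 1 / 100 * D ^ 2 := by gcongr
    linarith
  have him : |(A - 8 / 27).im + y / 2| ≤ D ^ 2 / 50 := by
    have : e.im = (A - 8 / 27).im + y / 2 := by
      rw [he, add_im]; simp
    rw [← this]
    exact (abs_im_le_norm e).trans heD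
  have him' := abs_le.mp him
  have hsmall : 11 * |φ| ^ 3 + 1700 * D ^ 2 ≤ |φ| := by
    have : |φ| ^ 2 ≤ (1 / 100) ^ 2 := by gcongr
    have : |φ| ^ 3 = |φ| * |φ| ^ 2 := by ring
    have : 100000 * D ^ 2 ≤ a * D ^ 2 := by gcongr
    nlinarith
  have b3' := abs_le.mp (b3.trans hsmall)
  refine ⟨norm_pos_iff.mp hD0, hre, by linarith, hμ, hsq, hε, fun hneg => ?_, fun hpos => ?_, l5.ne, ?_⟩
  · rw [abs_of_neg hneg] at b3'
    have hyneg : y < 0 := by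
      by_contra hcon
      push Not at hcon
      have : 0 ≤ a * y := by positivity
      linarith
    rw [abs_of_neg hyneg] at hy2
    linarith
  · rw [abs_of_pos hpos] at b3'
    have hypos : 0 < y := by
      by_contra hcon
      push Not at hcon
      have : a * y ≤ 0 := mul_nonpos_of_nonneg_of_nonpos ha0.le hcon
      linarith
    rw [abs_of_pos hypos] at hy2
    linarith
  · rw [show A - 8 / 27 = e - I * y / 2 by rw [he]; ring]
    exact norm_relative_error_le hφ0 hφ ha1 hD0 hDa1 b1 b2 b3 l1 l2 l3 l4 l5 hen

/-! ### The branch points in terms of `ε`. -/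

lemma norm_sub_le_of_mul {a b : ℂ} {c D : ℝ} (hD : 0 < D)
    (hab : ‖a * b‖ ≤ c * D ^ 4) (ha : D / 10 ≤ ‖a‖) : ‖b‖ ≤ 10 * c * D ^ 3 := by
  rw [norm_mul] at hab
  have h1 : D / 10 * ‖b‖ ≤ c * D ^ 4 := (by gcongr : D / 10 * ‖b‖ ≤ ‖a‖ * ‖b‖).trans hab
  have h2 : D * ‖b‖ ≤ D * (10 * c * D ^ 3) := by
    linarith [show c * D ^ 4 * 10 = D * (10 * c * D ^ 3) by ring]
  exact le_of_mul_le_mul_left h2 hD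

namespace LocalAsymptotics

variable {φ : ℝ} {ε d μ : ℂ}

lemma norm_le_eps (h : LocalAsymptotics φ ε d μ) (hφ : φ ≠ 0) : ‖d‖ ^ 2 ≤ 5 * ‖ε‖ := by
  have h1 := abs_im_le_norm ε
  have h2 := abs_le.mp h1
  rcases lt_or_gt_of_ne hφ with h3 | h3
  · linarith [h.im_pos h3]
  · linarith [h.im_neg h3]

lemma norm_small_root_error (h : LocalAsymptotics φ ε d μ) (hφ : φ ≠ 0) :
    ‖(-8 / 3 - 2 * μ) - (-8 / 3 - ε)‖ ≤ 150 * ‖ε ^ 2‖ := by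
  have e1 : (-8 / 3 - 2 * μ) - (-8 / 3 - ε) = μ ^ 2 * (4 + 2 * μ) := by rw [h.eps_eq]; ring
  have n := norm_nonneg d
  have hμ1 : ‖μ‖ ≤ 1 := h.norm_mu.trans (pow_le_one₀ n (by linarith [h.norm_le]))
  have e2 : ‖4 + 2 * μ‖ ≤ 6 := by
    refine (norm_add_le _ _).trans ?_
    rw [norm_mul, Complex.norm_ofNat, Complex.norm_ofNat]; linarith
  have e3 : ‖μ‖ ≤ 5 * ‖ε‖ := h.norm_mu.trans (h.norm_le_eps hφ)
  rw [e1, norm_mul, norm_pow, norm_pow]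
  calc ‖μ‖ ^ 2 * ‖4 + 2 * μ‖ ≤ (5 * ‖ε‖) ^ 2 * 6 := by gcongr
    _ = _ := by ring

/-- In `d² + s²` the linear terms in `μ` cancel. Once one factor is bounded below by a multiple of
`‖d‖`, the other is `O(‖d‖³)`. -/
lemma norm_mul_sub_add_le (h : LocalAsymptotics φ ε d μ) {s : ℂ} (hs : s ^ 2 = 2 * ε) :
    ‖(d - I * s) * (d + I * s)‖ ≤ 9 * ‖d‖ ^ 4 := by
  have e1 : (d - I * s) * (d + I * s) = μ ^ 2 * (5 + 4 * μ) := by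
    linear_combination h.sq_eq + hs + 2 * h.eps_eq - s ^ 2 * I_sq
  have n := norm_nonneg d
  have hμ1 : ‖μ‖ ≤ 1 := h.norm_mu.trans (pow_le_one₀ n (by linarith [h.norm_le]))
  have e2 : ‖5 + 4 * μ‖ ≤ 9 := by
    refine (norm_add_le _ _).trans ?_
    rw [norm_mul, Complex.norm_ofNat, Complex.norm_ofNat]; linarith
  rw [e1, norm_mul, norm_pow]
  calc ‖μ‖ ^ 2 * ‖5 + 4 * μ‖ ≤ (‖d‖ ^ 2) ^ 2 * 9 := by gcongr; exact h.norm_mu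
    _ = _ := by ring

lemma norm_root_le (h : LocalAsymptotics φ ε d μ) {s : ℂ} (hs : s ^ 2 = 2 * ε) :
    ‖s‖ ≤ 2 * ‖d‖ := by
  have e1 : s ^ 2 = (d - I * s) * (d + I * s) - d ^ 2 := by linear_combination s ^ 2 * I_sq
  have e2 := norm_sub_le ((d - I * s) * (d + I * s)) (d ^ 2)
  have e4 := h.norm_mul_sub_add_le hs
  have e3 : ‖s‖ ^ 2 ≤ (2 * ‖d‖) ^ 2 := by
    rw [← norm_pow, e1]
    rw [norm_pow] at e2
    have : ‖d‖ ^ 2 ≤ (1 / 1000) ^ 2 := by gcongr; exact h.norm_le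
    nlinarith [sq_nonneg ‖d‖]
  exact le_of_sq_le_sq e3 (by positivity)

/-- To the left of zero, the square root `s` of `2ε` has positive imaginary part, so that
`d ≈ -is`. -/
lemma norm_add_le_of_neg (h : LocalAsymptotics φ ε d μ) (hφ : φ < 0) {s : ℂ}
    (hs : s ^ 2 = 2 * ε) (hre : 0 ≤ s.re) : ‖d + I * s‖ ≤ 90 * ‖d‖ ^ 3 := by
  have hD : 0 < ‖d‖ := norm_pos_iff.mpr h.ne_zero
  have him : 2 * s.re * s.im = 2 * ε.im := by
    have := congrArg Complex.im hs
    simp only [sq, mul_im, im_ofNat, re_ofNat] at this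
    linarith
  have hpos := h.im_pos hφ
  have hsre : s.re ≤ 2 * ‖d‖ := (re_le_norm s).trans (h.norm_root_le hs)
  have hsim : ‖d‖ / 10 ≤ s.im := by
    by_contra hcon
    push Not at hcon
    have : s.re * s.im ≤ s.re * (‖d‖ / 10) := by gcongr
    have h0 : 0 < s.re := by
      refine lt_of_le_of_ne hre fun h0 => ?_
      rw [← h0] at him
      nlinarith
    have : s.re * s.im < s.re * (‖d‖ / 10) := by gcongr
    nlinarith
  -- `Re (d - I s) = Re d + Im s`, and neither term is negative.
  have hre' : ‖d‖ / 10 ≤ ‖d - I * s‖ := by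
    refine le_trans ?_ (re_le_norm _)
    simp
    linarith [h.re_nonneg]
  have := norm_sub_le_of_mul (c := 9) hD (h.norm_mul_sub_add_le hs) hre'
  linarith

/-- Now `Im ε < 0` forces `Im s < 0`, so `d + I s` is the factor bounded below. -/
lemma norm_sub_le_of_pos (h : LocalAsymptotics φ ε d μ) (hφ : 0 < φ) {s : ℂ}
    (hs : s ^ 2 = 2 * ε) (hre : 0 ≤ s.re) : ‖d - I * s‖ ≤ 90 * ‖d‖ ^ 3 := by
  have hD : 0 < ‖d‖ := norm_pos_iff.mpr h.ne_zero
  have him : 2 * s.re * s.im = 2 * ε.im := by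
    have := congrArg Complex.im hs
    simp only [sq, mul_im, im_ofNat, re_ofNat] at this
    linarith
  have hneg := h.im_neg hφ
  have hsre : s.re ≤ 2 * ‖d‖ := (re_le_norm s).trans (h.norm_root_le hs)
  have hsim : s.im ≤ -(‖d‖ / 10) := by
    by_contra hcon
    push Not at hcon
    have h0 : 0 < s.re := by
      refine lt_of_le_of_ne hre fun h0 => ?_
      rw [← h0] at him
      nlinarith
    have : s.re * -(‖d‖ / 10) < s.re * s.im := by gcongr
    nlinarith
  have hre' : ‖d‖ / 10 ≤ ‖d + I * s‖ := by
    refine le_trans ?_ (re_le_norm _)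
    simp
    linarith [h.re_nonneg]
  have hm := h.norm_mul_sub_add_le hs
  rw [mul_comm] at hm
  have := norm_sub_le_of_mul (c := 9) hD hm hre'
  linarith

lemma norm_add_le_eps (h : LocalAsymptotics φ ε d μ) (hφ : φ ≠ 0) {t : ℂ}
    (ht : ‖t‖ ≤ 90 * ‖d‖ ^ 3) : ‖μ‖ + ‖t‖ ≤ 10 * ‖ε‖ := by
  have h1 := h.norm_le_eps hφ
  have h2 : 90 * ‖d‖ ^ 3 ≤ ‖d‖ ^ 2 := by
    have : ‖d‖ ^ 3 = ‖d‖ ^ 2 * ‖d‖ := by ring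
    nlinarith [sq_nonneg ‖d‖, h.norm_le]
  linarith [h.norm_mu]

end LocalAsymptotics

/-! ### Assembling the global and the local part. -/

lemma eventually_localAsymptotics {A ζ₁ ζ₃ ζ₅ ε : ℝ → ℂ} (hA : ∀ φ : ℝ, SolvesBoutroux φ (A φ))
    (hζ : ∀ φ : ℝ, AreBranchPoints (A φ) (ζ₁ φ) (ζ₃ φ) (ζ₅ φ))
    (hε : ∀ φ : ℝ, A φ = 8 / 27 + ε φ) :
    ∀ᶠ φ in 𝓝[≠] 0, ∃ d μ, LocalAsymptotics φ (ε φ) d μ ∧ ζ₁ φ = -2 / 3 + μ + d ∧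
      ζ₃ φ = -2 / 3 + μ - d ∧ ζ₅ φ = -8 / 3 - 2 * μ := by
  have ht := tendsto_roots hA (fun φ => (hζ φ).isRootTriple)
    (fun φ => (hζ φ).re_le_53.trans (hζ φ).re_le_31) (fun φ => (hζ φ).re_le_53)
  have ht1 : Tendsto ζ₁ (𝓝 0) (𝓝 (-2 / 3)) := ht.fst_nhds
  have ht3 : Tendsto ζ₃ (𝓝 0) (𝓝 (-2 / 3)) := ht.snd_nhds.fst_nhds
  have hd : Tendsto (fun φ => ‖(ζ₁ φ - ζ₃ φ) / 2‖) (𝓝 0) (𝓝 0) := by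
    simpa using ((ht1.sub ht3).div_const 2).norm
  have hμ : Tendsto (fun φ => ‖(ζ₁ φ + ζ₃ φ) / 2 + 2 / 3‖) (𝓝 0) (𝓝 0) := by
    have := (((ht1.add ht3).div_const 2).add_const (2 / 3)).norm
    norm_num at this
    exact this
  have hφ : Tendsto (fun φ : ℝ => |φ|) (𝓝 0) (𝓝 0) := by
    simpa using (continuous_abs.tendsto (0 : ℝ))
  have hd' := hd.eventually_le_const (Real.exp_pos (-100000))
  have hμ' := hμ.eventually_le_const one_pos
  have hφ' := hφ.eventually_le_const (show (0 : ℝ) < 1 / 100 by norm_num)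
  filter_upwards [hd'.filter_mono nhdsWithin_le_nhds, hμ'.filter_mono nhdsWithin_le_nhds,
    hφ'.filter_mono nhdsWithin_le_nhds, self_mem_nhdsWithin] with φ g1 g2 g3 g4
  set d := (ζ₁ φ - ζ₃ φ) / 2 with hdd
  set μ := (ζ₁ φ + ζ₃ φ) / 2 + 2 / 3 with hμμ
  have e1 : ζ₁ φ = -2 / 3 + μ + d := by rw [hdd, hμμ]; ring
  have e3 : ζ₃ φ = -2 / 3 + μ - d := by rw [hdd, hμμ]; ring
  have e5 : ζ₅ φ = -8 / 3 - 2 * μ := by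
    have := (hζ φ).isRootTriple.sum
    rw [hμμ]; linear_combination this
  have hr := (hζ φ).isRootTriple
  rw [e1, e3, e5] at hr
  have hre : 0 ≤ d.re := by
    have h := (hζ φ).re_le_31
    rw [e1, e3] at h
    simp only [add_re, sub_re] at h
    linarith
  have hl := (hA φ).localAsymptotics hr hre g1 g2 g3 g4
  rw [show A φ - 8 / 27 = ε φ by rw [hε]; ring] at hl
  exact ⟨d, μ, hl, e1, e3, e5⟩

end

theorem proposition8p19
    (A ζ₁ ζ₃ ζ₅ ε : ℝ → ℂ)
    (hA : ∀ φ : ℝ, SolvesBoutroux φ (A φ))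
    (hζ : ∀ φ : ℝ, AreBranchPoints (A φ) (ζ₁ φ) (ζ₃ φ) (ζ₅ φ))
    (hε : ∀ φ : ℝ, A φ = 8 / 27 + ε φ) :
    -- the asymptotics of `ε`, with `ln φ` and `ln ln φ` read as `ln |φ|` and `ln |ln |φ||`
    (∃ r : ℝ → ℂ,
      r =O[𝓝[≠] 0] (fun φ : ℝ => Real.log (abs (Real.log |φ|)) / Real.log |φ|) ∧
      ∀ᶠ φ : ℝ in 𝓝[≠] 0,
        ε φ = 8 * Complex.I / 3 * ((φ / Real.log |φ| : ℝ) : ℂ) * (1 + r φ)) ∧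
    -- the branch points as `φ → 0-`
    (fun φ => ζ₁ φ - (-2 / 3 - Complex.I ^ 1 * (2 * ε φ) ^ (1 / 2 : ℂ))) =O[𝓝[<] 0] ε ∧
    (fun φ => ζ₃ φ - (-2 / 3 - Complex.I ^ 3 * (2 * ε φ) ^ (1 / 2 : ℂ))) =O[𝓝[<] 0] ε ∧
    (fun φ => ζ₅ φ - (-8 / 3 - ε φ)) =O[𝓝[<] 0] (fun φ => ε φ ^ 2) ∧
    -- the branch points as `φ → 0+`
    (fun φ => ζ₁ φ - (-2 / 3 + Complex.I ^ 1 * (2 * ε φ) ^ (1 / 2 : ℂ))) =O[𝓝[>] 0] ε ∧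
    (fun φ => ζ₃ φ - (-2 / 3 + Complex.I ^ 3 * (2 * ε φ) ^ (1 / 2 : ℂ))) =O[𝓝[>] 0] ε ∧
    (fun φ => ζ₅ φ - (-8 / 3 - ε φ)) =O[𝓝[>] 0] (fun φ => ε φ ^ 2) := by
  have ev := eventually_localAsymptotics hA hζ hε
  have evl := ev.filter_mono (nhdsWithin_mono 0 fun φ (h : φ < 0) => h.ne)
  have evr := ev.filter_mono (nhdsWithin_mono 0 fun φ (h : 0 < φ) => h.ne')
  have hs : ∀ φ, ((2 * ε φ) ^ (1 / 2 : ℂ)) ^ 2 = 2 * ε φ := fun φ => by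
    have := sqrt_sq_eq (2 * ε φ)
    rwa [Complex.sqrt, ← one_div] at this
  have hsre : ∀ φ, 0 ≤ ((2 * ε φ) ^ (1 / 2 : ℂ)).re := fun φ => by
    have := sqrt_re_nonneg (2 * ε φ)
    rwa [Complex.sqrt, ← one_div] at this
  refine ⟨⟨fun φ => ε φ / (8 * Complex.I / 3 * ((φ / Real.log |φ| : ℝ) : ℂ)) - 1, ?_, ?_⟩,
    ?_, ?_, ?_, ?_, ?_, ?_⟩
  · refine IsBigO.of_bound 150000 ?_
    filter_upwards [ev] with φ ⟨d, μ, h, _⟩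
    exact h.rel
  · filter_upwards [ev, self_mem_nhdsWithin] with φ ⟨d, μ, h, _⟩ hφ
    have h1 : (φ : ℂ) ≠ 0 := by exact_mod_cast hφ
    have h2 : (Real.log |φ| : ℂ) ≠ 0 := by exact_mod_cast h.log_ne
    have h3 : 8 * Complex.I / 3 * ((φ / Real.log |φ| : ℝ) : ℂ) ≠ 0 := by
      rw [Complex.ofReal_div]
      exact mul_ne_zero (by simp) (div_ne_zero h1 h2)
    rw [add_sub_cancel, mul_div_cancel₀ _ h3]
  · refine IsBigO.of_bound 10 ?_
    filter_upwards [evl, self_mem_nhdsWithin] with φ ⟨d, μ, h, e, _⟩ (hφ : φ < 0)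
    have hb := h.norm_add_le_of_neg hφ (hs φ) (hsre φ)
    rw [e, pow_one, show ∀ s : ℂ, -2 / 3 + μ + d - (-2 / 3 - Complex.I * s)
      = μ + (d + Complex.I * s) from fun s => by ring]
    exact (norm_add_le _ _).trans (h.norm_add_le_eps hφ.ne hb)
  · refine IsBigO.of_bound 10 ?_
    filter_upwards [evl, self_mem_nhdsWithin] with φ ⟨d, μ, h, _, e, _⟩ (hφ : φ < 0)
    have hb := h.norm_add_le_of_neg hφ (hs φ) (hsre φ)
    rw [e, Complex.I_pow_three, show ∀ s : ℂ, -2 / 3 + μ - d - (-2 / 3 - -Complex.I * s)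
      = μ - (d + Complex.I * s) from fun s => by ring]
    exact (norm_sub_le _ _).trans (h.norm_add_le_eps hφ.ne hb)
  · refine IsBigO.of_bound 150 ?_
    filter_upwards [evl, self_mem_nhdsWithin] with φ ⟨d, μ, h, _, _, e⟩ (hφ : φ < 0)
    rw [e]
    exact h.norm_small_root_error hφ.ne
  · refine IsBigO.of_bound 10 ?_
    filter_upwards [evr, self_mem_nhdsWithin] with φ ⟨d, μ, h, e, _⟩ (hφ : 0 < φ)
    have hb := h.norm_sub_le_of_pos hφ (hs φ) (hsre φ)
    rw [e, pow_one, show ∀ s : ℂ, -2 / 3 + μ + d - (-2 / 3 + Complex.I * s)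
      = μ + (d - Complex.I * s) from fun s => by ring]
    exact (norm_add_le _ _).trans (h.norm_add_le_eps hφ.ne' hb)
  · refine IsBigO.of_bound 10 ?_
    filter_upwards [evr, self_mem_nhdsWithin] with φ ⟨d, μ, h, _, e, _⟩ (hφ : 0 < φ)
    have hb := h.norm_sub_le_of_pos hφ (hs φ) (hsre φ)
    rw [e, Complex.I_pow_three, show ∀ s : ℂ, -2 / 3 + μ - d - (-2 / 3 + -Complex.I * s)
      = μ - (d - Complex.I * s) from fun s => by ring]
    exact (norm_sub_le _ _).trans (h.norm_add_le_eps hφ.ne' hb)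
  · refine IsBigO.of_bound 150 ?_
    filter_upwards [evr, self_mem_nhdsWithin] with φ ⟨d, μ, h, _, _, e⟩ (hφ : 0 < φ)
    rw [e]
    exact h.norm_small_root_error hφ.ne'
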